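/- **Setting.** Let $d\ge 3$, $n_1,\dots,n_d$ and $R$ be given. For tensors $\mathcal A\in\mathbb R^{n_1\times\cdots\times n_d}$ let $\langle\cdot,\cdot\rangle$ be the entrywise inner product and $\|\cdot\|$ the induced (Frobenius) norm. A tuple $(U_1,\dots,U_d)$, $U_j=[\mathbf u_{j,1},\dots,\mathbf u_{j,R}]\in\mathbb R^{n_j\times R}$, is called *feasible* if the columns of $U_1,\dots,U_{d-1}$ are unit vectors and $U_d^\top U_d=I$. Put $$G(U_1,\dots,U_d)=\sum_{i=1}^R\Big\langle\mathcal A,\bigotimes_{j=1}^d\mathbf u_{j,i}\Big\rangle^2,$$ and let $G_{\max}$ be the maximum of $G$ over all feasible tuples. **Algorithm ($t=1$).** Given $\mathcal A$: (1) let $\mathbf u^0_{d,1},\dots,\mathbf u^0_{d,R}$ be leading $R$ unit left singular vectors of the mode-$d$ unfolding $A_{(d)}$; (2) for each $i$ let $(\mathbf u^0_{1,i},\dots,\mathbf u^0_{d-1,i})$ be the unit vectors returned by a rank-one approximation procedure applied to $\mathcal A\times_d(\mathbf u^0_{d,i})^\top\in\mathbb R^{n_1\times\cdots\times n_{d-1}}$.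 The rank-one procedure may be any one of the following: * exact best rank-one approximation (maximization of $\langle\mathcal C,\bigotimes_j\mathbf x_j\rangle$ over unit vectors $\mathbf x_j$); * the sequential procedure, that is, the approximation algorithm itself with $R=1$ and all factors orthonormal: for an input $\mathcal C$ of order $m$, $\mathbf x_m$ is a leading left singular vector of $C_{(m)}$; then for $j=m-1,\dots,1$ one takes $\mathcal B_j=\mathcal C\times_{j+1}\mathbf x_{j+1}^\top\cdots\times_m\mathbf x_m^\top$, unfolds it to the matrix $M_j$ with $n_j$ rows, forms $\mathbf v_j=M_j\mathbf y_j$ (and $\mathbf v_1=\mathcal B_1$ for $j=1$), and lets $\mathbf x_j$ be a unit vector with $\mathbf v_j=\|\mathbf v_j\|\mathbf x_j$; here $\mathbf y_j$ is either a leading unit right singular vector of $M_j$, or the normalization of the first row of $M_j$ of largest magnitude; * any procedure that is quasi-optimal in the sense that, for some constant $\kappa$ and every input $\mathcal C$, it returns unit vectors $\mathbf x_j$ such that $\|\mathcal C-\langle\mathcal C,\bigotimes_j\mathbf x_j\rangle\bigotimes_j\mathbf x_j\|\le\kappa\,\|\mathcal C-\mathcal T\|$ for every tensor $\mathcal T$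 of rank at most one. (Where singular vectors, maximizers or polar factors are not unique, any choice is allowed.) **Proposition.** Fix $d\ge 3$, $n_1,\dots,n_d$, $R$, scalars $\sigma_1>\cdots>\sigma_R>0$ and a rank-one procedure as above. There are constants $\varepsilon>0$ and $C_1,C_2\ge0$, depending only on these data, such that the following holds. Let $$\mathcal A=\sum_{i=1}^R\sigma_i\bigotimes_{j=1}^d\mathbf u_{j,i}+\mathcal E,$$ where $(U_1,\dots,U_d)$ is feasible and, for some $j\le d-1$ and some $0\le\delta<1$, the matrix $U_j$ is $\delta$-incoherent, that is, $|\langle\mathbf u_{j,i_1},\mathbf u_{j,i_2}\rangle|\le\delta$ for all $i_1\ne i_2$. If $\delta\le\varepsilon$ and $\|\mathcal E\|\le\varepsilon$, then $G_{\max}$ exists and every output $(U^0_1,\dots,U^0_d)$ of the algorithm on $\mathcal A$ satisfies $$G_{\max}-C_1\delta-C_2\|\mathcal E\|\;\le\;G(U^0_1,\dots,U^0_d)\;\le\;G_{\max}$$ and $$\min\{\|\mathbf u^0_{j,i}+\mathbf u_{j,i}\|,\ \|\mathbf u^0_{j,i}-\mathbf u_{j,i}\|\}\le C_1\delta+C_2\|\mathcal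 E\|,\qquad j=1,\dots,d,\ i=1,\dots,R.$$ -/

import Mathlib

noncomputable section

/-- The space `ℝ^{n₁ × ⋯ × n_d}` of real tensors; its norm is the Frobenius norm and its inner
product is the sum of the entrywise products. -/
abbrev Tensor {d : ℕ} (n : Fin d → ℕ) : Type :=
  EuclideanSpace ℝ ((j : Fin d) → Fin (n j))

/-- A tuple `(x₁, …, x_d)` of vectors with `x_j ∈ ℝ^{n_j}`. -/
abbrev VecTuple {d : ℕ} (n : Fin d → ℕ) : Type :=
  (j : Fin d) → EuclideanSpace ℝ (Fin (n j))

/-- A tuple `(U₁, …, U_d)` of factor matrices, `U_j ∈ ℝ^{n_j × R}`, stored by columns: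
`U j i` is the `i`-th column `u_{j,i}` of `U_j`. -/
abbrev FactorTuple {d : ℕ} (n : Fin d → ℕ) (R : ℕ) : Type :=
  (j : Fin d) → Fin R → EuclideanSpace ℝ (Fin (n j))

/-- The rank-one tensor `x₁ ⊗ ⋯ ⊗ x_d`. -/
def outer {d : ℕ} {n : Fin d → ℕ} (x : VecTuple n) : Tensor n :=
  WithLp.toLp 2 fun k => ∏ j, x j (k j)

/-- The sizes `(n₁, …, n_{d-1})`. -/
abbrev dropLast {m : ℕ} (n : Fin (m + 1) → ℕ) : Fin m → ℕ := fun j => n j.castSucc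

/-- The mode-`d` unfolding `A_(d)`; rows are indexed by the last tensor index and columns by the
tuple of the remaining ones. -/
def unfoldLast {m : ℕ} {n : Fin (m + 1) → ℕ} (A : Tensor n) :
    Matrix (Fin (n (Fin.last m))) ((j : Fin m) → Fin (dropLast n j)) ℝ :=
  Matrix.of fun l k => A (Fin.snoc (α := fun j => Fin (n j)) k l)

/-- The tensor-vector product `A ×_d uᵀ` along the last mode. -/
def contractLast {m : ℕ} {n : Fin (m + 1) → ℕ} (A : Tensor n)
    (u : EuclideanSpace ℝ (Fin (n (Fin.last m)))) : Tensor (dropLast n) :=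
  WithLp.toLp 2 fun k => ∑ l, A (Fin.snoc (α := fun j => Fin (n j)) k l) * u l

/-- `u 0, …, u (R-1)` are leading `R` unit right singular vectors of `T`: they are orthonormal and
`T* T uᵢ = sᵢ² uᵢ`, where `s₀ ≥ s₁ ≥ ⋯` are the singular values of `T` with multiplicity. -/
def IsLeadingRightSingular {E F : Type*} [NormedAddCommGroup E] [InnerProductSpace ℝ E]
    [FiniteDimensional ℝ E] [NormedAddCommGroup F] [InnerProductSpace ℝ F]
    [FiniteDimensional ℝ F] {R : ℕ} (T : E →ₗ[ℝ] F) (u : Fin R → E) : Prop :=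
  Orthonormal ℝ u ∧
    ∀ i : Fin R, LinearMap.adjoint T (T (u i)) = (T.singularValues (i : ℕ) ^ 2) • u i

/-- `u 0, …, u (R-1)` are leading `R` unit left singular vectors of the matrix `M`. -/
def IsLeadingLeftSingular {p R : ℕ} {ι : Type*} [Fintype ι] [DecidableEq ι]
    (M : Matrix (Fin p) ι ℝ) (u : Fin R → EuclideanSpace ℝ (Fin p)) : Prop :=
  IsLeadingRightSingular (Matrix.toEuclideanLin M.transpose) u

/-! ### The optimization problem with one orthonormal factor (`t = 1`) -/

/-- `U_d` is (columnwise) orthonormal and `U₁, …, U_{d-1}` are columnwise normalized. -/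
def Feasible {m R : ℕ} {n : Fin (m + 1) → ℕ} (U : FactorTuple n R) : Prop :=
  (∀ (j : Fin m) (i : Fin R), ‖U j.castSucc i‖ = 1) ∧ Orthonormal ℝ (U (Fin.last m))

/-- The objective `G(U₁, …, U_d) = ∑ᵢ ⟨A, u_{1,i} ⊗ ⋯ ⊗ u_{d,i}⟩²`. -/
def objective {m R : ℕ} {n : Fin (m + 1) → ℕ} (A : Tensor n) (U : FactorTuple n R) : ℝ :=
  ∑ i : Fin R, (inner ℝ A (outer fun j => U j i)) ^ 2

/-! ### Rank-one approximation procedures -/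

/-- A (possibly multivalued) rank-one approximation procedure for tensors of size `n`:
`P C x` says that `x = (x₁, …, x_d)` is a possible output on the input `C`. -/
abbrev RankOneProcedure {d : ℕ} (n : Fin d → ℕ) : Type := Tensor n → VecTuple n → Prop

/-- The outputs are normalized, and the error of the rank-one approximation
`⟨C, x₁ ⊗ ⋯ ⊗ x_d⟩ x₁ ⊗ ⋯ ⊗ x_d` of `C` is at most `κ` times the error of every other
rank-one approximation. -/
def IsQuasiOptimal {d : ℕ} {n : Fin d → ℕ} (κ : ℝ) (P : RankOneProcedure n) : Prop :=
  ∀ (C : Tensor n) (x : VecTuple n), P C x →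
    (∀ j, ‖x j‖ = 1) ∧
    ∀ z : VecTuple n, ‖C - (inner ℝ C (outer x) : ℝ) • outer x‖ ≤ κ * ‖C - outer z‖

/-- Exact best rank-one approximation: maximize `⟨C, x₁ ⊗ ⋯ ⊗ x_d⟩` over unit vectors. -/
def bestRankOne {d : ℕ} (n : Fin d → ℕ) : RankOneProcedure n := fun C x =>
  (∀ j, ‖x j‖ = 1) ∧
    ∀ z : VecTuple n, (∀ j, ‖z j‖ = 1) → (inner ℝ C (outer z) : ℝ) ≤ inner ℝ C (outer x)

/-- The two deterministic ways to extract a vector `v = M y` from a matrix `M`. -/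
inductive ExtractionRule where
  | leadingSingular
  | largestRow

/-- `y` is a possible choice of the rule for the matrix `M`: a leading unit right singular vector
of `M`, or the normalization of the first row of `M` of largest magnitude. -/
def ExtractionRule.Selects (rule : ExtractionRule) {p : ℕ} {ι : Type*} [Fintype ι]
    [DecidableEq ι] (M : Matrix (Fin p) ι ℝ) (y : EuclideanSpace ℝ ι) : Prop :=
  match rule with
  | .leadingSingular => IsLeadingRightSingular (Matrix.toEuclideanLin M) (fun _ : Fin 1 => y)
  | .largestRow =>
      let row : Fin p → EuclideanSpace ℝ ι := fun k => WithLp.toLp 2 (M k)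
      ∃ k : Fin p, (∀ l, ‖row l‖ ≤ ‖row k‖) ∧ (∀ l, l < k → ‖row l‖ < ‖row k‖) ∧
        y = ‖row k‖⁻¹ • row k

/-- The loop of the sequential procedure. For `j = d, d-1, …, 1`, with `B_j` the current tensor of
order `j` and `M_j` its unfolding along the last mode: let `v_j = M_j y_j` where `y_j` is chosen by
the rule (for `j = 1`, `v_1 = B_1`, that is, `y_1 = 1`); let the unit vector `x_j` be a polar factor
of `v_j`, that is, `v_j = ‖v_j‖ x_j`; and put `B_{j-1} = B_j ×_j x_jᵀ`. -/
def sequentialLoop (rule : ExtractionRule) : {d : ℕ} → (n : Fin d → ℕ) → RankOneProcedure n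
  | 0, _ => fun _ _ => True
  | m + 1, n => fun B x =>
      (∃ y : EuclideanSpace ℝ ((j : Fin m) → Fin (dropLast n j)),
        (if m = 0 then y = WithLp.toLp 2 (fun _ => 1) else rule.Selects (unfoldLast B) y) ∧
        ‖x (Fin.last m)‖ = 1 ∧
        Matrix.toEuclideanLin (unfoldLast B) y
          = ‖Matrix.toEuclideanLin (unfoldLast B) y‖ • x (Fin.last m)) ∧
      sequentialLoop rule (dropLast n) (contractLast B (x (Fin.last m))) (fun j => x j.castSucc)

/-- The sequential rank-one procedure (the approximation algorithm with `R = 1` in which all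
factors are orthonormal): `x_d` is a leading left singular vector of the mode-`d` unfolding, and
`x_{d-1}, …, x_1` are then computed by the loop above. -/
def sequentialRankOne (rule : ExtractionRule) : {d : ℕ} → (n : Fin d → ℕ) → RankOneProcedure n
  | 0, _ => fun _ _ => True
  | m + 1, n => fun C x =>
      IsLeadingLeftSingular (unfoldLast C) (fun _ : Fin 1 => x (Fin.last m)) ∧
      sequentialLoop rule (dropLast n) (contractLast C (x (Fin.last m))) (fun j => x j.castSucc)

/-! ### The approximation algorithm with `t = 1` -/

/-- `U` is a possible output of the algorithm with `t = 1` on the tensor `A`: the columns of `U_d`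
are leading `R` left singular vectors of the mode-`d` unfolding of `A`, and for each `i` the vectors
`(u_{1,i}, …, u_{d-1,i})` are an output of the rank-one procedure on `A ×_d u_{d,i}ᵀ`. -/
def IsAlgorithmOutput {m R : ℕ} {n : Fin (m + 1) → ℕ} (P : RankOneProcedure (dropLast n))
    (A : Tensor n) (U : FactorTuple n R) : Prop :=
  IsLeadingLeftSingular (unfoldLast A) (U (Fin.last m)) ∧
    ∀ i : Fin R, P (contractLast A (U (Fin.last m) i)) (fun j => U j.castSucc i)

/-- Some `U_j` with `j ≤ d - 1` is incoherent with modulus `δ`. -/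
def Incoherent {m R : ℕ} {n : Fin (m + 1) → ℕ} (δ : ℝ) (U : FactorTuple n R) : Prop :=
  ∃ j : Fin m, ∀ i₁ i₂ : Fin R, i₁ ≠ i₂ →
    |(inner ℝ (U j.castSucc i₁) (U j.castSucc i₂) : ℝ)| ≤ δ

end

noncomputable section

section Tensors

variable {m : ℕ} {n : Fin (m + 1) → ℕ}

/-- The tensor `T ⊗ u`, where `u` is placed in the last mode. -/
def tensorSnoc (T : Tensor (dropLast n)) (u : EuclideanSpace ℝ (Fin (n (Fin.last m)))) :
    Tensor n :=
  WithLp.toLp 2 fun k => T (fun j => k j.castSucc) * u (k (Fin.last m))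

/-- The slice of a tensor with fixed last index. -/
def lastSlice (A : Tensor n) (l : Fin (n (Fin.last m))) : Tensor (dropLast n) :=
  WithLp.toLp 2 (unfoldLast A l)

theorem lastSlice_apply (A : Tensor n) (l : Fin (n (Fin.last m))) (k) :
    lastSlice A l k = A (Fin.snoc (α := fun j => Fin (n j)) k l) := rfl

theorem contractLast_apply (A : Tensor n) (u : EuclideanSpace ℝ (Fin (n (Fin.last m)))) (k) :
    contractLast A u k = ∑ l, A (Fin.snoc (α := fun j => Fin (n j)) k l) * u l := rfl

theorem tensorSnoc_snoc (T : Tensor (dropLast n)) (u : EuclideanSpace ℝ (Fin (n (Fin.last m))))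
    (k : (j : Fin m) → Fin (dropLast n j)) (l : Fin (n (Fin.last m))) :
    tensorSnoc T u (Fin.snoc (α := fun j => Fin (n j)) k l) = T k * u l := by
  simp [tensorSnoc]

theorem sum_tensor_index {M : Type*} [AddCommMonoid M] (f : ((j : Fin (m + 1)) → Fin (n j)) → M) :
    ∑ k, f k = ∑ l, ∑ k : (j : Fin m) → Fin (dropLast n j),
      f (Fin.snoc (α := fun j => Fin (n j)) k l) := by
  rw [← Fintype.sum_prod_type']
  exact ((Fin.snocEquiv fun j => Fin (n j)).sum_comp f).symm

theorem tensor_ext {A B : Tensor n} (h : ∀ k l,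
    A (Fin.snoc (α := fun j => Fin (n j)) k l) = B (Fin.snoc (α := fun j => Fin (n j)) k l)) :
    A = B := by
  ext k
  have := h (fun j => k j.castSucc) (k (Fin.last m))
  have hk : Fin.snoc (α := fun j => Fin (n j)) (fun j => k j.castSucc) (k (Fin.last m)) = k :=
    Fin.snoc_init_self k
  rwa [hk] at this

theorem euclidean_inner_eq_sum {ι : Type*} [Fintype ι] (x y : EuclideanSpace ℝ ι) :
    inner ℝ x y = ∑ i, x i * y i := by
  simp [PiLp.inner_apply, mul_comm]

theorem outer_eq_tensorSnoc (x : VecTuple n) :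
    outer x = tensorSnoc (outer fun j => x j.castSucc) (x (Fin.last m)) := by
  ext k
  simp [outer, tensorSnoc, Fin.prod_univ_castSucc]

theorem inner_tensorSnoc (B : Tensor n) (T : Tensor (dropLast n))
    (u : EuclideanSpace ℝ (Fin (n (Fin.last m)))) :
    (inner ℝ B (tensorSnoc T u) : ℝ) = inner ℝ (contractLast B u) T := by
  simp only [euclidean_inner_eq_sum]
  rw [sum_tensor_index, Finset.sum_comm]
  refine Finset.sum_congr rfl fun k _ => ?_
  rw [contractLast_apply, Finset.sum_mul]
  refine Finset.sum_congr rfl fun l _ => ?_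
  rw [tensorSnoc_snoc]
  ring

theorem contractLast_tensorSnoc (T : Tensor (dropLast n))
    (v u : EuclideanSpace ℝ (Fin (n (Fin.last m)))) :
    contractLast (tensorSnoc T v) u = (inner ℝ v u : ℝ) • T := by
  ext k
  simp only [contractLast_apply, tensorSnoc_snoc, PiLp.smul_apply, smul_eq_mul,
    euclidean_inner_eq_sum, Finset.sum_mul]
  exact Finset.sum_congr rfl fun l _ => by ring

theorem inner_tensorSnoc_tensorSnoc (S T : Tensor (dropLast n))
    (u v : EuclideanSpace ℝ (Fin (n (Fin.last m)))) :
    (inner ℝ (tensorSnoc S u) (tensorSnoc T v) : ℝ) = inner ℝ u v * inner ℝ S T := by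
  rw [inner_tensorSnoc, contractLast_tensorSnoc, real_inner_smul_left]

theorem norm_tensorSnoc (T : Tensor (dropLast n)) (u : EuclideanSpace ℝ (Fin (n (Fin.last m)))) :
    ‖tensorSnoc T u‖ = ‖T‖ * ‖u‖ := by
  have h := inner_tensorSnoc_tensorSnoc T T u u
  rw [real_inner_self_eq_norm_sq, real_inner_self_eq_norm_sq, real_inner_self_eq_norm_sq] at h
  rw [← abs_of_nonneg (norm_nonneg (tensorSnoc T u)), ← abs_of_nonneg (a := ‖T‖ * ‖u‖)
    (by positivity), ← sq_eq_sq_iff_abs_eq_abs, h]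
  ring

theorem tensorSnoc_sub_left (S T : Tensor (dropLast n))
    (u : EuclideanSpace ℝ (Fin (n (Fin.last m)))) :
    tensorSnoc (S - T) u = tensorSnoc S u - tensorSnoc T u := by
  ext k; simp [tensorSnoc, sub_mul]

theorem tensorSnoc_smul_left (c : ℝ) (T : Tensor (dropLast n))
    (u : EuclideanSpace ℝ (Fin (n (Fin.last m)))) :
    tensorSnoc (c • T) u = c • tensorSnoc T u := by
  ext k; simp [tensorSnoc, mul_assoc]

theorem contractLast_sub (A B : Tensor n) (u : EuclideanSpace ℝ (Fin (n (Fin.last m)))) :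
    contractLast (A - B) u = contractLast A u - contractLast B u := by
  ext k; simp [contractLast_apply, sub_mul]

theorem contractLast_add (A B : Tensor n) (u : EuclideanSpace ℝ (Fin (n (Fin.last m)))) :
    contractLast (A + B) u = contractLast A u + contractLast B u := by
  ext k; simp [contractLast_apply, add_mul, Finset.sum_add_distrib]

theorem contractLast_smul (c : ℝ) (A : Tensor n) (u : EuclideanSpace ℝ (Fin (n (Fin.last m)))) :
    contractLast (c • A) u = c • contractLast A u := by
  ext k; simp [contractLast_apply, mul_assoc, Finset.mul_sum]

theorem contractLast_sum {ι : Type*} (s : Finset ι) (A : ι → Tensor n)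
    (u : EuclideanSpace ℝ (Fin (n (Fin.last m)))) :
    contractLast (∑ i ∈ s, A i) u = ∑ i ∈ s, contractLast (A i) u := by
  ext k
  simp only [contractLast_apply, WithLp.ofLp_sum, Finset.sum_apply, Finset.sum_mul]
  exact Finset.sum_comm

theorem norm_contractLast_le (A : Tensor n) (u : EuclideanSpace ℝ (Fin (n (Fin.last m)))) :
    ‖contractLast A u‖ ≤ ‖A‖ * ‖u‖ := by
  have h := real_inner_le_norm A (tensorSnoc (contractLast A u) u)
  rw [inner_tensorSnoc, real_inner_self_eq_norm_sq, norm_tensorSnoc] at h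
  by_contra! hlt
  have h0 : 0 < ‖contractLast A u‖ := lt_of_le_of_lt (by positivity) hlt
  nlinarith

theorem toEuclideanLin_unfoldLast_transpose (A : Tensor n)
    (u : EuclideanSpace ℝ (Fin (n (Fin.last m)))) :
    Matrix.toEuclideanLin (unfoldLast A).transpose u = contractLast A u := by
  ext k
  simp [Matrix.toLpLin_apply, Matrix.mulVec, dotProduct, contractLast_apply, unfoldLast]

theorem toEuclideanLin_unfoldLast_apply (A : Tensor n)
    (y : EuclideanSpace ℝ ((j : Fin m) → Fin (dropLast n j))) (l) :
    Matrix.toEuclideanLin (unfoldLast A) y l = inner ℝ (lastSlice A l) y := by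
  rw [euclidean_inner_eq_sum]
  simp [Matrix.toLpLin_apply, Matrix.mulVec, dotProduct, lastSlice]

theorem inner_toEuclideanLin_unfoldLast (A : Tensor n)
    (u : EuclideanSpace ℝ (Fin (n (Fin.last m))))
    (y : EuclideanSpace ℝ ((j : Fin m) → Fin (dropLast n j))) :
    (inner ℝ u (Matrix.toEuclideanLin (unfoldLast A) y) : ℝ) = inner ℝ (contractLast A u) y := by
  simp only [euclidean_inner_eq_sum, toEuclideanLin_unfoldLast_apply, contractLast_apply,
    Finset.sum_mul, Finset.mul_sum, lastSlice_apply]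
  rw [Finset.sum_comm]
  exact Finset.sum_congr rfl fun k _ => Finset.sum_congr rfl fun l _ => by ring

theorem norm_sq_eq_sum_lastSlice (A : Tensor n) : ‖A‖ ^ 2 = ∑ l, ‖lastSlice A l‖ ^ 2 := by
  simp only [EuclideanSpace.real_norm_sq_eq, lastSlice_apply]
  exact sum_tensor_index _

theorem norm_lastSlice_le (A : Tensor n) (l : Fin (n (Fin.last m))) : ‖lastSlice A l‖ ≤ ‖A‖ := by
  rw [← sq_le_sq₀ (norm_nonneg _) (norm_nonneg _), norm_sq_eq_sum_lastSlice]
  exact Finset.single_le_sum (f := fun l => ‖lastSlice A l‖ ^ 2) (fun _ _ => by positivity)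
    (Finset.mem_univ l)

theorem norm_le_sum_lastSlice (A : Tensor n) : ‖A‖ ≤ ∑ l, ‖lastSlice A l‖ := by
  rw [← sq_le_sq₀ (norm_nonneg _) (by positivity), norm_sq_eq_sum_lastSlice]
  exact Finset.sum_sq_le_sq_sum_of_nonneg fun _ _ => norm_nonneg _

theorem lastSlice_sub (A B : Tensor n) (l : Fin (n (Fin.last m))) :
    lastSlice (A - B) l = lastSlice A l - lastSlice B l := rfl

theorem lastSlice_tensorSnoc (T : Tensor (dropLast n))
    (u : EuclideanSpace ℝ (Fin (n (Fin.last m)))) (l : Fin (n (Fin.last m))) :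
    lastSlice (tensorSnoc T u) l = u l • T := by
  ext k
  simp [lastSlice_apply, tensorSnoc_snoc, mul_comm]

end Tensors

section Outer

variable {d : ℕ} {n : Fin d → ℕ}

theorem inner_outer (x y : VecTuple n) :
    (inner ℝ (outer x) (outer y) : ℝ) = ∏ j, inner ℝ (x j) (y j) := by
  simp only [euclidean_inner_eq_sum, outer, ← Finset.prod_mul_distrib]
  rw [Finset.prod_univ_sum, Fintype.piFinset_univ]

theorem norm_outer (x : VecTuple n) (hx : ∀ j, ‖x j‖ = 1) : ‖outer x‖ = 1 := by
  have h : ‖outer x‖ ^ 2 = 1 := by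
    rw [← real_inner_self_eq_norm_sq, inner_outer]
    simp [hx]
  exact (pow_eq_one_iff_of_nonneg (norm_nonneg _) two_ne_zero).1 h

theorem outer_smul_update (x : VecTuple n) (j : Fin d) (c : ℝ) :
    outer (Function.update x j (c • x j)) = c • outer x := by
  ext k
  simp only [outer, PiLp.smul_apply, smul_eq_mul]
  rw [← Finset.mul_prod_erase _ _ (Finset.mem_univ j),
    ← Finset.mul_prod_erase Finset.univ (fun i => x i (k i)) (Finset.mem_univ j), ← mul_assoc]
  congr 1
  · simp
  · refine Finset.prod_congr rfl fun i hi => ?_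
    rw [Function.update_of_ne (Finset.ne_of_mem_erase hi)]

/-- The inner product of unit rank-one tensors is bounded by that of any pair of factors. -/
theorem abs_inner_outer_le (x y : VecTuple n) (hx : ∀ j, ‖x j‖ = 1) (hy : ∀ j, ‖y j‖ = 1)
    (j : Fin d) : |(inner ℝ (outer x) (outer y) : ℝ)| ≤ |(inner ℝ (x j) (y j) : ℝ)| := by
  rw [inner_outer, Finset.abs_prod, ← Finset.mul_prod_erase _ _ (Finset.mem_univ j)]
  refine mul_le_of_le_one_right (abs_nonneg _) (Finset.prod_le_one (fun _ _ => abs_nonneg _)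
    fun i _ => ?_)
  simpa [hx, hy] using abs_real_inner_le_norm (x i) (y i)

end Outer

section SingularVectors

variable {E F : Type*} [NormedAddCommGroup E] [InnerProductSpace ℝ E] [FiniteDimensional ℝ E]
  [NormedAddCommGroup F] [InnerProductSpace ℝ F] [FiniteDimensional ℝ F]

theorem exists_orthonormalBasis_isLeadingRightSingular (T : E →ₗ[ℝ] F) :
    ∃ e : OrthonormalBasis (Fin (Module.finrank ℝ E)) ℝ E, IsLeadingRightSingular T e := by
  refine ⟨T.isSymmetric_adjoint_comp_self.eigenvectorBasis rfl,
    OrthonormalBasis.orthonormal _, fun i => ?_⟩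
  rw [T.sq_singularValues_fin rfl]
  exact T.isSymmetric_adjoint_comp_self.apply_eigenvectorBasis rfl i

theorem IsLeadingRightSingular.inner_apply {R : ℕ} {T : E →ₗ[ℝ] F} {u : Fin R → E}
    (h : IsLeadingRightSingular T u) (i : Fin R) (y : E) :
    (inner ℝ (T (u i)) (T y) : ℝ) = T.singularValues i ^ 2 * inner ℝ (u i) y := by
  rw [← LinearMap.adjoint_inner_left, h.2 i, real_inner_smul_left]

theorem IsLeadingRightSingular.norm_apply_sq {R : ℕ} {T : E →ₗ[ℝ] F} {u : Fin R → E}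
    (h : IsLeadingRightSingular T u) (i : Fin R) : ‖T (u i)‖ ^ 2 = T.singularValues i ^ 2 := by
  rw [← real_inner_self_eq_norm_sq, h.inner_apply, real_inner_self_eq_norm_sq, h.1.1 i]
  simp

theorem IsLeadingRightSingular.norm_apply {R : ℕ} {T : E →ₗ[ℝ] F} {u : Fin R → E}
    (h : IsLeadingRightSingular T u) (i : Fin R) : ‖T (u i)‖ = T.singularValues i := by
  rw [← abs_of_nonneg (norm_nonneg _), ← abs_of_nonneg (T.singularValues_nonneg i),
    ← sq_eq_sq_iff_abs_eq_abs, h.norm_apply_sq]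

theorem norm_apply_sq_le_of_orthogonal {T : E →ₗ[ℝ] F}
    {e : OrthonormalBasis (Fin (Module.finrank ℝ E)) ℝ E} (he : IsLeadingRightSingular T e)
    (i : ℕ) (x : E) (hx : ∀ k : Fin (Module.finrank ℝ E), (k : ℕ) < i → (inner ℝ (e k) x : ℝ) = 0) :
    ‖T x‖ ^ 2 ≤ T.singularValues i ^ 2 * ‖x‖ ^ 2 := by
  have h1 : ‖T x‖ ^ 2 = ∑ k : Fin (Module.finrank ℝ E),
      T.singularValues k ^ 2 * (inner ℝ (e k) x : ℝ) ^ 2 := by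
    rw [← real_inner_self_eq_norm_sq]
    conv_lhs => enter [2]; rw [← e.sum_repr' x, map_sum]
    rw [sum_inner]
    refine Finset.sum_congr rfl fun k _ => ?_
    rw [map_smul, real_inner_smul_left, he.inner_apply]
    ring
  have h2 : ‖x‖ ^ 2 = ∑ k, (inner ℝ (e k) x : ℝ) ^ 2 := by
    rw [← e.sum_sq_norm_inner_right x]
    simp
  rw [h1, h2, Finset.mul_sum]
  refine Finset.sum_le_sum fun k _ => ?_
  rcases lt_or_ge (k : ℕ) i with hk | hk
  · simp [hx k hk]
  · have := T.singularValues_antitone hk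
    have := T.singularValues_nonneg k
    gcongr

theorem norm_apply_le_singularValues_zero (T : E →ₗ[ℝ] F) (x : E) :
    ‖T x‖ ≤ T.singularValues 0 * ‖x‖ := by
  obtain ⟨e, he⟩ := exists_orthonormalBasis_isLeadingRightSingular T
  have h := norm_apply_sq_le_of_orthogonal he 0 x (by simp)
  rw [← mul_pow] at h
  exact (sq_le_sq₀ (norm_nonneg _) (mul_nonneg (T.singularValues_nonneg 0) (norm_nonneg _))).1 h

end SingularVectors

section RankOneError

variable {E : Type*} [NormedAddCommGroup E] [InnerProductSpace ℝ E]

theorem norm_sub_inner_smul_sq (a b : E) (hb : ‖b‖ = 1) :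
    ‖a - (inner ℝ a b : ℝ) • b‖ ^ 2 = ‖a‖ ^ 2 - (inner ℝ a b : ℝ) ^ 2 := by
  rw [norm_sub_sq_real, real_inner_smul_right, norm_smul, hb, mul_one, Real.norm_eq_abs, sq_abs]
  ring

theorem norm_sub_inner_smul_le (a b : E) (hb : ‖b‖ = 1) (c : ℝ) :
    ‖a - (inner ℝ a b : ℝ) • b‖ ≤ ‖a - c • b‖ := by
  rw [← sq_le_sq₀ (norm_nonneg _) (norm_nonneg _), norm_sub_inner_smul_sq a b hb,
    norm_sub_sq_real, real_inner_smul_right, norm_smul, hb, mul_one, Real.norm_eq_abs, sq_abs]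
  nlinarith [sq_nonneg (c - inner ℝ a b)]

/-- For vectors `a`, `b` close to multiples `w`, `w'` of a common vector with `‖a‖ ≤ ‖b‖`, the
vector `a` is close to a multiple of `b`. -/
theorem exists_norm_sub_smul_le (a b t : E) (w w' e : ℝ) (hab : ‖a‖ ≤ ‖b‖)
    (ha : ‖a - w • t‖ ≤ e) (hb : ‖b - w' • t‖ ≤ e) : ∃ c : ℝ, ‖a - c • b‖ ≤ 4 * e := by
  have he : 0 ≤ e := (norm_nonneg _).trans ha
  have key : ∃ c : ℝ, |c| ≤ 1 ∧ |w - c * w'| * ‖t‖ ≤ 2 * e := by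
    rcases le_or_gt |w| |w'| with h | h
    · rcases eq_or_ne w' 0 with h0 | h0
      · have : w = 0 := by simpa [h0] using h
        exact ⟨0, by simp, by simp [this, he]⟩
      · refine ⟨w / w', ?_, ?_⟩
        · rw [abs_div]; exact div_le_one_of_le₀ h (abs_nonneg _)
        · rw [div_mul_cancel₀ _ h0]; simp [he]
    · have h1 : |w| * ‖t‖ ≤ ‖a‖ + e := by
        have := norm_sub_norm_le (w • t) a
        rw [norm_sub_rev, norm_smul, Real.norm_eq_abs] at this
        linarith
      have h2 : ‖b‖ ≤ |w'| * ‖t‖ + e := by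
        have := norm_sub_norm_le b (w' • t)
        rw [norm_smul, Real.norm_eq_abs] at this
        linarith
      have h3 : (|w| - |w'|) * ‖t‖ ≤ 2 * e := by nlinarith
      rcases le_total 0 w with hw | hw <;> rcases le_total 0 w' with hw' | hw' <;>
        simp only [abs_of_nonneg, abs_of_nonpos, hw, hw'] at h h3
      · exact ⟨1, by simp, by rw [abs_of_nonneg (by linarith)]; linarith⟩
      · exact ⟨-1, by simp, by rw [abs_of_nonneg (by linarith)]; linarith⟩
      · exact ⟨-1, by simp, by rw [abs_of_nonpos (by linarith)]; linarith⟩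
      · exact ⟨1, by simp, by rw [abs_of_nonpos (by linarith)]; linarith⟩
  obtain ⟨c, hc, hc'⟩ := key
  refine ⟨c, ?_⟩
  have : a - c • b = (a - w • t) - c • (b - w' • t) + (w - c * w') • t := by
    module
  rw [this]
  refine (norm_add_le _ _).trans ?_
  have h1 := norm_sub_le (a - w • t) (c • (b - w' • t))
  rw [norm_smul, Real.norm_eq_abs] at h1
  rw [norm_smul, Real.norm_eq_abs]
  have : |c| * ‖b - w' • t‖ ≤ 1 * e := by gcongr
  linarith

end RankOneError

section ContractionStep

variable {m : ℕ} {n : Fin (m + 1) → ℕ}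

theorem norm_sub_tensorSnoc_contractLast_sq (B : Tensor n)
    (x : EuclideanSpace ℝ (Fin (n (Fin.last m)))) (hx : ‖x‖ = 1) :
    ‖B - tensorSnoc (contractLast B x) x‖ ^ 2 = ‖B‖ ^ 2 - ‖contractLast B x‖ ^ 2 := by
  rw [norm_sub_sq_real, inner_tensorSnoc, norm_tensorSnoc, hx, real_inner_self_eq_norm_sq]
  ring

theorem norm_sub_tensorSnoc_contractLast_le (B : Tensor n)
    (x : EuclideanSpace ℝ (Fin (n (Fin.last m)))) (hx : ‖x‖ = 1) (T : Tensor (dropLast n)) :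
    ‖B - tensorSnoc (contractLast B x) x‖ ≤ ‖B - tensorSnoc T x‖ := by
  rw [← sq_le_sq₀ (norm_nonneg _) (norm_nonneg _), norm_sub_tensorSnoc_contractLast_sq B x hx,
    norm_sub_sq_real, inner_tensorSnoc, norm_tensorSnoc, hx]
  have := real_inner_le_norm (contractLast B x) T
  nlinarith [sq_nonneg (‖contractLast B x‖ - ‖T‖)]

/-- If `x` maximizes `‖B ×_d xᵀ‖`, then projecting the last mode onto `x` is at least as good as any
approximation by a tensor of the form `T ⊗ w`. -/
theorem norm_sub_tensorSnoc_contractLast_le_of_maximal (B : Tensor n)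
    (x : EuclideanSpace ℝ (Fin (n (Fin.last m)))) (hx : ‖x‖ = 1)
    (hmax : ∀ w, ‖contractLast B w‖ ≤ ‖contractLast B x‖ * ‖w‖)
    (T : Tensor (dropLast n)) (w : EuclideanSpace ℝ (Fin (n (Fin.last m)))) :
    ‖B - tensorSnoc (contractLast B x) x‖ ≤ ‖B - tensorSnoc T w‖ := by
  rw [← sq_le_sq₀ (norm_nonneg _) (norm_nonneg _), norm_sub_tensorSnoc_contractLast_sq B x hx,
    norm_sub_sq_real, inner_tensorSnoc, norm_tensorSnoc]
  have h1 := real_inner_le_norm (contractLast B w) T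
  have h2 : ‖contractLast B w‖ * ‖T‖ ≤ ‖contractLast B x‖ * ‖w‖ * ‖T‖ := by gcongr; exact hmax w
  nlinarith [sq_nonneg (‖contractLast B x‖ - ‖T‖ * ‖w‖)]

theorem IsLeadingLeftSingular.contractLast_maximal {B : Tensor n}
    {x : EuclideanSpace ℝ (Fin (n (Fin.last m)))}
    (h : IsLeadingLeftSingular (unfoldLast B) (fun _ : Fin 1 => x))
    (w : EuclideanSpace ℝ (Fin (n (Fin.last m)))) :
    ‖contractLast B w‖ ≤ ‖contractLast B x‖ * ‖w‖ := by
  have h1 := IsLeadingRightSingular.norm_apply h 0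
  have h2 := norm_apply_le_singularValues_zero (Matrix.toEuclideanLin (unfoldLast B).transpose) w
  simp only [toEuclideanLin_unfoldLast_transpose] at h1 h2
  rw [h1]
  exact h2

theorem contractLast_maximal_of_leadingRightSingular {B : Tensor n}
    {y : EuclideanSpace ℝ ((j : Fin m) → Fin (dropLast n j))}
    {x : EuclideanSpace ℝ (Fin (n (Fin.last m)))}
    (h : IsLeadingRightSingular (Matrix.toEuclideanLin (unfoldLast B)) (fun _ : Fin 1 => y))
    (hx : ‖x‖ = 1)
    (hxy : Matrix.toEuclideanLin (unfoldLast B) y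
      = ‖Matrix.toEuclideanLin (unfoldLast B) y‖ • x)
    (w : EuclideanSpace ℝ (Fin (n (Fin.last m)))) :
    ‖contractLast B w‖ ≤ ‖contractLast B x‖ * ‖w‖ := by
  set M := Matrix.toEuclideanLin (unfoldLast B) with hM
  have hy : ‖y‖ = 1 := h.1.1 0
  have hs : ‖M y‖ = M.singularValues 0 := h.norm_apply 0
  have hx' : M.singularValues 0 ≤ ‖contractLast B x‖ := by
    have h1 : (inner ℝ x (M y) : ℝ) = ‖M y‖ := by
      conv_lhs => rw [hxy]
      rw [real_inner_smul_right, real_inner_self_eq_norm_sq, hx]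
      simp
    rw [hM, inner_toEuclideanLin_unfoldLast] at h1
    have h2 := real_inner_le_norm (contractLast B x) y
    rw [h1, hy, mul_one, hs] at h2
    exact h2
  have h1 : ‖contractLast B w‖ ^ 2 ≤ ‖w‖ * (M.singularValues 0 * ‖contractLast B w‖) := by
    rw [← real_inner_self_eq_norm_sq, ← inner_toEuclideanLin_unfoldLast]
    refine (real_inner_le_norm _ _).trans ?_
    gcongr
    exact norm_apply_le_singularValues_zero M _
  have h2 : ‖contractLast B w‖ ≤ M.singularValues 0 * ‖w‖ := by
    by_contra! hlt
    have h0 : 0 < ‖contractLast B w‖ :=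
      lt_of_le_of_lt (mul_nonneg (M.singularValues_nonneg 0) (norm_nonneg _)) hlt
    nlinarith
  exact h2.trans (by gcongr)

/-- Approximation of `B` by `(M y) ⊗ y`, with `y` the normalization of the largest row of `M`. -/
theorem norm_sub_tensorSnoc_contractLast_le_of_largestRow (B : Tensor n)
    (y : EuclideanSpace ℝ ((j : Fin m) → Fin (dropLast n j)))
    (x : EuclideanSpace ℝ (Fin (n (Fin.last m)))) (hx : ‖x‖ = 1)
    (hxy : Matrix.toEuclideanLin (unfoldLast B) y
      = ‖Matrix.toEuclideanLin (unfoldLast B) y‖ • x)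
    (k : Fin (n (Fin.last m))) (hk : ∀ l, ‖lastSlice B l‖ ≤ ‖lastSlice B k‖)
    (hy : y = ‖lastSlice B k‖⁻¹ • lastSlice B k)
    (T : Tensor (dropLast n)) (w : EuclideanSpace ℝ (Fin (n (Fin.last m)))) :
    ‖B - tensorSnoc (contractLast B x) x‖
      ≤ (n (Fin.last m) * 4 : ℝ) * ‖B - tensorSnoc T w‖ := by
  set e := ‖B - tensorSnoc T w‖ with he
  have hrow : ∀ l, ‖lastSlice B l - w l • T‖ ≤ e := fun l => by
    rw [← lastSlice_tensorSnoc, ← lastSlice_sub]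
    exact norm_lastSlice_le _ l
  set v := Matrix.toEuclideanLin (unfoldLast B) y with hv
  have hslice : ∀ l, ‖lastSlice (B - tensorSnoc (‖v‖ • y) x) l‖ ≤ 4 * e := fun l => by
    have h1 : lastSlice (B - tensorSnoc (‖v‖ • y) x) l
        = lastSlice B l - (inner ℝ (lastSlice B l) y : ℝ) • y := by
      rw [lastSlice_sub, lastSlice_tensorSnoc, ← toEuclideanLin_unfoldLast_apply, ← hv, smul_smul]
      congr 2
      conv_rhs => rw [hxy]
      simp [mul_comm]
    rw [h1]
    obtain ⟨c, hc⟩ := exists_norm_sub_smul_le _ _ _ _ _ _ (hk l) (hrow l) (hrow k)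
    rcases eq_or_ne (lastSlice B k) 0 with h0 | h0
    · have : y = 0 := by rw [hy, h0]; simp
      rw [h0] at hc
      rw [this]
      simpa using hc
    · have hy1 : ‖y‖ = 1 := by
        rw [hy, norm_smul, norm_inv, norm_norm, inv_mul_cancel₀ (norm_ne_zero_iff.2 h0)]
      have hk' : lastSlice B k = ‖lastSlice B k‖ • y := by
        rw [hy, smul_smul, mul_inv_cancel₀ (norm_ne_zero_iff.2 h0), one_smul]
      rw [hk', smul_smul] at hc
      exact (norm_sub_inner_smul_le _ _ hy1 _).trans hc
  calc ‖B - tensorSnoc (contractLast B x) x‖ ≤ ‖B - tensorSnoc (‖v‖ • y) x‖ :=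
        norm_sub_tensorSnoc_contractLast_le B x hx _
    _ ≤ ∑ l, ‖lastSlice (B - tensorSnoc (‖v‖ • y) x) l‖ := norm_le_sum_lastSlice _
    _ ≤ ∑ _l : Fin (n (Fin.last m)), 4 * e := Finset.sum_le_sum fun l _ => hslice l
    _ = _ := by simp; ring

end ContractionStep

section Procedures

/-- Quasi-optimality with respect to multiples of rank-one tensors with unit factors. -/
def IsUnitQuasiOptimal {d : ℕ} {n : Fin d → ℕ} (κ : ℝ) (P : RankOneProcedure n) : Prop :=
  ∀ (C : Tensor n) (x : VecTuple n), P C x →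
    (∀ j, ‖x j‖ = 1) ∧
    ∀ (c : ℝ) (z : VecTuple n), (∀ j, ‖z j‖ = 1) →
      ‖C - (inner ℝ C (outer x) : ℝ) • outer x‖ ≤ κ * ‖C - c • outer z‖

theorem IsQuasiOptimal.isUnitQuasiOptimal {d : ℕ} {n : Fin d → ℕ} {κ : ℝ}
    {P : RankOneProcedure n} (h : IsQuasiOptimal κ P) (j : Fin d) : IsUnitQuasiOptimal κ P := by
  intro C x hx
  refine ⟨(h C x hx).1, fun c z _ => ?_⟩
  have := (h C x hx).2 (Function.update z j (c • z j))
  rwa [outer_smul_update] at this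

theorem bestRankOne_isUnitQuasiOptimal {d : ℕ} (n : Fin d → ℕ) (j : Fin d) :
    IsUnitQuasiOptimal 1 (bestRankOne n) := by
  rintro C x ⟨hx, hmax⟩
  refine ⟨hx, fun c z hz => ?_⟩
  have hox := norm_outer x hx
  have hoz := norm_outer z hz
  have h1 := hmax z hz
  have h2 : -(inner ℝ C (outer z) : ℝ) ≤ inner ℝ C (outer x) := by
    have := hmax (Function.update z j ((-1 : ℝ) • z j)) fun i => by
      rcases eq_or_ne i j with rfl | hi
      · simp [hz]
      · simp [hi, hz]
    rw [outer_smul_update, real_inner_smul_right] at this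
    linarith
  have h3 : (inner ℝ C (outer z) : ℝ) ^ 2 ≤ (inner ℝ C (outer x) : ℝ) ^ 2 :=
    sq_le_sq' (by linarith) h1
  rw [one_mul]
  refine le_trans ?_ (norm_sub_inner_smul_le C (outer z) hoz c)
  rw [← sq_le_sq₀ (norm_nonneg _) (norm_nonneg _), norm_sub_inner_smul_sq C _ hox,
    norm_sub_inner_smul_sq C _ hoz]
  linarith

variable {m : ℕ} {n : Fin (m + 1) → ℕ}

/-- Errors of the projection of the last mode and of the rank-one approximation of the contracted
tensor add up. -/
theorem rankOne_error_le_of_contractLast {K κ : ℝ} (hκ : 0 ≤ κ) (B : Tensor n) (x z : VecTuple n)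
    (c : ℝ) (hx : ‖x (Fin.last m)‖ = 1)
    (hstep : ‖B - tensorSnoc (contractLast B (x (Fin.last m))) (x (Fin.last m))‖
      ≤ K * ‖B - c • outer z‖)
    (hrec : ∀ c' : ℝ, ‖contractLast B (x (Fin.last m))
        - (inner ℝ (contractLast B (x (Fin.last m))) (outer fun j : Fin m => x j.castSucc) : ℝ)
          • outer fun j : Fin m => x j.castSucc‖
      ≤ κ * ‖contractLast B (x (Fin.last m)) - c' • outer fun j : Fin m => z j.castSucc‖) :
    ‖B - (inner ℝ B (outer x) : ℝ) • outer x‖ ≤ (K + κ) * ‖B - c • outer z‖ := by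
  set u := x (Fin.last m) with hu
  set C := contractLast B u with hC
  set x' : VecTuple (dropLast n) := fun j => x j.castSucc with hx'
  set z' : VecTuple (dropLast n) := fun j => z j.castSucc with hz'
  have hox : outer x = tensorSnoc (outer x') u := outer_eq_tensorSnoc x
  have hoz : outer z = tensorSnoc (outer z') (z (Fin.last m)) := outer_eq_tensorSnoc z
  have h1 : ‖C - (inner ℝ C (outer x') : ℝ) • outer x'‖ ≤ κ * ‖B - c • outer z‖ := by
    refine (hrec (c * inner ℝ (z (Fin.last m)) u)).trans ?_
    have : C - (c * inner ℝ (z (Fin.last m)) u) • outer z' = contractLast (B - c • outer z) u := by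
      rw [contractLast_sub, contractLast_smul, hoz, contractLast_tensorSnoc, smul_smul]
    rw [this]
    have := norm_contractLast_le (B - c • outer z) u
    rw [hx, mul_one] at this
    gcongr
  have h2 : B - (inner ℝ B (outer x) : ℝ) • outer x
      = (B - tensorSnoc C u) + tensorSnoc (C - (inner ℝ C (outer x') : ℝ) • outer x') u := by
    rw [hox, inner_tensorSnoc, tensorSnoc_sub_left, tensorSnoc_smul_left]
    abel
  rw [h2]
  refine (norm_add_le _ _).trans ?_
  rw [norm_tensorSnoc, hx, mul_one]
  linarith

theorem smul_outer_eq_tensorSnoc (c : ℝ) (z : VecTuple n) :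
    c • outer z = tensorSnoc (c • outer fun j : Fin m => z j.castSucc) (z (Fin.last m)) := by
  rw [tensorSnoc_smul_left, outer_eq_tensorSnoc]

theorem sequentialLoop_step {rule : ExtractionRule} (B : Tensor n) (x z : VecTuple n) (c : ℝ)
    (h : sequentialLoop rule n B x) :
    ‖B - tensorSnoc (contractLast B (x (Fin.last m))) (x (Fin.last m))‖
      ≤ (n (Fin.last m) * 4 + 1 : ℝ) * ‖B - c • outer z‖ := by
  obtain ⟨⟨y, hy, hx, hxy⟩, -⟩ := h
  have hnn : 0 ≤ ‖B - c • outer z‖ := norm_nonneg _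
  have hp : (0 : ℝ) ≤ n (Fin.last m) * 4 := by positivity
  split_ifs at hy with hm
  · have hB : B = tensorSnoc
        (‖Matrix.toEuclideanLin (unfoldLast B) y‖ • y) (x (Fin.last m)) := by
      refine tensor_ext fun k l => ?_
      rw [tensorSnoc_snoc]
      have h1 : Matrix.toEuclideanLin (unfoldLast B) y l
          = B (Fin.snoc (α := fun j => Fin (n j)) k l) := by
        subst hm
        rw [toEuclideanLin_unfoldLast_apply, euclidean_inner_eq_sum, hy,
          Fintype.sum_eq_single k fun k' hk' => (hk' (Subsingleton.elim _ _)).elim]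
        simp [lastSlice_apply]
      rw [← h1]
      conv_lhs => rw [hxy]
      simp [hy]
    have h2 := norm_sub_tensorSnoc_contractLast_le B _ hx
      (‖Matrix.toEuclideanLin (unfoldLast B) y‖ • y)
    rw [← hB, sub_self, norm_zero] at h2
    exact h2.trans (by positivity)
  · rw [smul_outer_eq_tensorSnoc] at hnn ⊢
    cases rule with
    | leadingSingular =>
      have := norm_sub_tensorSnoc_contractLast_le_of_maximal B _ hx
        (contractLast_maximal_of_leadingRightSingular hy hx hxy)
        (c • outer fun j : Fin m => z j.castSucc) (z (Fin.last m))
      nlinarith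
    | largestRow =>
      obtain ⟨k, hk, -, hyk⟩ := hy
      have := norm_sub_tensorSnoc_contractLast_le_of_largestRow B y _ hx hxy k hk hyk
        (c • outer fun j : Fin m => z j.castSucc) (z (Fin.last m))
      nlinarith

theorem exists_sequentialLoop_isUnitQuasiOptimal (rule : ExtractionRule) :
    ∀ {d : ℕ} (n : Fin d → ℕ), ∃ κ : ℝ, 0 ≤ κ ∧ IsUnitQuasiOptimal κ (sequentialLoop rule n)
  | 0, n => by
    refine ⟨0, le_rfl, fun C x _ => ⟨fun j => j.elim0, fun c z _ => ?_⟩⟩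
    have h : (inner ℝ C (outer x) : ℝ) • outer x = C := by
      ext k
      rw [euclidean_inner_eq_sum,
        Fintype.sum_eq_single k fun k' hk' => (hk' (Subsingleton.elim _ _)).elim]
      simp [outer]
    simp [h]
  | d + 1, n => by
    obtain ⟨κ, hκ, hP⟩ := exists_sequentialLoop_isUnitQuasiOptimal rule (dropLast n)
    refine ⟨n (Fin.last d) * 4 + 1 + κ, by positivity, fun C x hCx => ?_⟩
    have hCx' := hCx
    obtain ⟨⟨y, -, hx, -⟩, hloop⟩ := hCx'
    have hrec := hP _ _ hloop
    refine ⟨Fin.lastCases hx hrec.1, fun c z hz => ?_⟩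
    exact rankOne_error_le_of_contractLast hκ C x z c hx (sequentialLoop_step C x z c hCx)
      fun c' => hrec.2 c' _ fun j => hz _

theorem exists_sequentialRankOne_isUnitQuasiOptimal (rule : ExtractionRule) (n : Fin (m + 1) → ℕ) :
    ∃ κ : ℝ, IsUnitQuasiOptimal κ (sequentialRankOne rule n) := by
  obtain ⟨κ, hκ, hP⟩ := exists_sequentialLoop_isUnitQuasiOptimal rule (dropLast n)
  refine ⟨1 + κ, fun C x hCx => ?_⟩
  obtain ⟨hlead, hloop⟩ := hCx
  have hx : ‖x (Fin.last m)‖ = 1 := hlead.1.1 0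
  have hrec := hP _ _ hloop
  refine ⟨Fin.lastCases hx hrec.1, fun c z hz => ?_⟩
  refine rankOne_error_le_of_contractLast hκ C x z c hx ?_ fun c' => hrec.2 c' _ fun j => hz _
  rw [one_mul, smul_outer_eq_tensorSnoc]
  exact norm_sub_tensorSnoc_contractLast_le_of_maximal C _ hx hlead.contractLast_maximal _ _

end Procedures

section SpectralPerturbation

variable {E F : Type*} [NormedAddCommGroup E] [InnerProductSpace ℝ E]
  [NormedAddCommGroup F] [InnerProductSpace ℝ F]

theorem exists_combination_orthogonal {i : ℕ} (w : Fin (i + 1) → E) (e : Fin i → E) :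
    ∃ c : Fin (i + 1) → ℝ, c ≠ 0 ∧ ∀ k, (inner ℝ (e k) (∑ l, c l • w l) : ℝ) = 0 := by
  let f : (Fin (i + 1) → ℝ) →ₗ[ℝ] (Fin i → ℝ) :=
    LinearMap.pi fun k => (innerₛₗ ℝ (e k)) ∘ₗ (Fintype.linearCombination ℝ w)
  obtain ⟨c, hc, hc0⟩ := (Submodule.ne_bot_iff _).1
    (LinearMap.ker_ne_bot_of_finrank_lt (f := f) (by simp))
  refine ⟨c, hc0, fun k => ?_⟩
  have := congrFun (LinearMap.mem_ker.1 hc) k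
  simpa [f, Fintype.linearCombination_apply] using this

theorem Orthonormal.sum_inner_sq_le {ι : Type*} [Fintype ι] {u : ι → E} (hu : Orthonormal ℝ u)
    (x : E) : ∑ k, (inner ℝ (u k) x : ℝ) ^ 2 ≤ ‖x‖ ^ 2 := by
  simpa using hu.sum_inner_products_le x (s := Finset.univ)

theorem Orthonormal.norm_sq_combination {ι : Type*} [Fintype ι] {w : ι → E}
    (hw : Orthonormal ℝ w) (c : ι → ℝ) : ‖∑ l, c l • w l‖ ^ 2 = ∑ l, c l ^ 2 := by
  rw [← real_inner_self_eq_norm_sq, hw.inner_sum]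
  simp [sq]

theorem norm_sq_combination_pos {ι : Type*} [Fintype ι] {w : ι → E} (hw : Orthonormal ℝ w)
    {c : ι → ℝ} (hc : c ≠ 0) : 0 < ‖∑ l, c l • w l‖ ^ 2 := by
  rw [hw.norm_sq_combination]
  obtain ⟨l, hl⟩ := Function.ne_iff.1 hc
  exact Finset.sum_pos' (fun _ _ => sq_nonneg _) ⟨l, Finset.mem_univ l, sq_pos_of_ne_zero hl⟩

/-- `T` is a linear map for which `T* T` differs from `∑ μ_k u_k u_kᵀ` by at most `η` in operator
norm. -/
def GramClose {R : ℕ} (T : E →ₗ[ℝ] F) (u : Fin R → E) (μ : Fin R → ℝ) (η : ℝ) : Prop :=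
  ∀ x y, |(inner ℝ (T x) (T y) : ℝ) - ∑ k, μ k * ((inner ℝ (u k) x : ℝ) * inner ℝ (u k) y)|
    ≤ η * (‖x‖ * ‖y‖)

theorem GramClose.abs_norm_sq_sub_le {R : ℕ} {T : E →ₗ[ℝ] F} {u : Fin R → E} {μ : Fin R → ℝ}
    {η : ℝ} (H : GramClose T u μ η) (x : E) :
    |‖T x‖ ^ 2 - ∑ k, μ k * (inner ℝ (u k) x : ℝ) ^ 2| ≤ η * ‖x‖ ^ 2 := by
  have := H x x
  simpa only [real_inner_self_eq_norm_sq, ← sq] using this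

section Eigenvector

variable {R : ℕ} {T : E →ₗ[ℝ] F} {u : Fin R → E} {μ : Fin R → ℝ} {η lam γ : ℝ} {i : Fin R} {x : E}

theorem GramClose.abs_eigen_sub_le (H : GramClose T u μ η) (hx : ‖x‖ = 1)
    (hlam : ∀ y, (inner ℝ (T x) (T y) : ℝ) = lam * inner ℝ x y) (y : E) :
    |lam * (inner ℝ x y : ℝ) - ∑ k, μ k * ((inner ℝ (u k) x : ℝ) * inner ℝ (u k) y)|
      ≤ η * ‖y‖ := by
  have := H x y
  rwa [hlam, hx, one_mul] at this

theorem GramClose.abs_inner_le (H : GramClose T u μ η) (hu : Orthonormal ℝ u) (hx : ‖x‖ = 1)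
    (hlam : ∀ y, (inner ℝ (T x) (T y) : ℝ) = lam * inner ℝ x y) (hγ : 0 < γ) {k : Fin R}
    (hk : γ ≤ |lam - μ k|) : |(inner ℝ (u k) x : ℝ)| ≤ η / γ := by
  have h := H.abs_eigen_sub_le hx hlam (u k)
  rw [Finset.sum_eq_single k (fun l _ hl => by rw [hu.2 hl]; simp)
    (by simp), real_inner_self_eq_norm_sq, hu.1 k, real_inner_comm] at h
  have h' : |lam - μ k| * |(inner ℝ (u k) x : ℝ)| ≤ η := by
    rw [← abs_mul]
    convert h using 1
    · congr 1; ring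
    · ring
  rw [le_div_iff₀ hγ, mul_comm]
  exact le_trans (by gcongr) h'

theorem GramClose.norm_sub_inner_smul_le (H : GramClose T u μ η) (hu : Orthonormal ℝ u)
    (hx : ‖x‖ = 1) (hlam : ∀ y, (inner ℝ (T x) (T y) : ℝ) = lam * inner ℝ x y) (hγ : 0 < γ)
    (hη : 0 ≤ η) (hgap : ∀ k, k ≠ i → γ ≤ |lam - μ k|) (hpos : γ ≤ lam) :
    ‖x - (inner ℝ x (u i) : ℝ) • u i‖ ≤ (R + 1) * (η / γ) := by
  set w := x - ∑ k, (inner ℝ (u k) x : ℝ) • u k with hw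
  have hortho : ∀ k, (inner ℝ (u k) w : ℝ) = 0 := fun k => by
    rw [hw, inner_sub_right, hu.inner_right_fintype, sub_self]
  have hxw : (inner ℝ x w : ℝ) = ‖w‖ ^ 2 := by
    have : x = w + ∑ k, (inner ℝ (u k) x : ℝ) • u k := by rw [hw]; abel
    rw [← real_inner_self_eq_norm_sq]
    conv_lhs => rw [this]
    rw [inner_add_left, sum_inner]
    simp [real_inner_smul_left, hortho]
  have hwn : ‖w‖ ≤ η / γ := by
    have h := H.abs_eigen_sub_le hx hlam w
    simp only [hortho, mul_zero, Finset.sum_const_zero, sub_zero, hxw] at h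
    have h' := (le_abs_self _).trans h
    rw [le_div_iff₀ hγ]
    by_contra! hlt
    have h0 : 0 < ‖w‖ := by
      rcases (norm_nonneg w).eq_or_lt with h0 | h0
      · rw [← h0] at hlt; linarith
      · exact h0
    nlinarith
  have hdecomp : x - (inner ℝ x (u i) : ℝ) • u i
      = w + ∑ k ∈ Finset.univ.erase i, (inner ℝ (u k) x : ℝ) • u k := by
    rw [hw, ← Finset.add_sum_erase _ _ (Finset.mem_univ i), real_inner_comm]
    abel
  rw [hdecomp]
  calc _ ≤ ‖w‖ + ∑ k ∈ Finset.univ.erase i, ‖(inner ℝ (u k) x : ℝ) • u k‖ :=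
        (norm_add_le _ _).trans (by gcongr; exact norm_sum_le _ _)
    _ ≤ η / γ + ∑ _k ∈ Finset.univ.erase i, η / γ := by
        gcongr with k hk
        rw [norm_smul, hu.1 k, mul_one, Real.norm_eq_abs]
        exact H.abs_inner_le hu hx hlam hγ (hgap k (Finset.ne_of_mem_erase hk))
    _ ≤ η / γ + R * (η / γ) := by
        rw [Finset.sum_const, nsmul_eq_mul]
        have : ((Finset.univ.erase i).card : ℝ) ≤ R := by
          have := Finset.card_le_univ (Finset.univ.erase i)
          simp
        gcongr
    _ = _ := by ring

end Eigenvector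

/-- A map of the form `x ↦ ∑ σ_k ⟨u_k, x⟩ v_k` with nearly orthonormal `v_k`, up to a small error,
has nearly the Gram form `∑ σ_k² u_k u_kᵀ`. -/
theorem gramClose_of_approx {R : ℕ} {T : E →ₗ[ℝ] F} {u : Fin R → E} {v : Fin R → F}
    {σ : Fin R → ℝ} {δ e : ℝ} (hu : ∀ k, ‖u k‖ = 1) (hv : ∀ k, ‖v k‖ = 1)
    (hvv : ∀ k l, k ≠ l → |(inner ℝ (v k) (v l) : ℝ)| ≤ δ) (hσ : ∀ k, 0 ≤ σ k) (hδ : 0 ≤ δ)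
    (he : 0 ≤ e) (he1 : e ≤ 1)
    (hT : ∀ x, ‖T x - ∑ k, (σ k * inner ℝ (u k) x : ℝ) • v k‖ ≤ e * ‖x‖) :
    GramClose T u (fun k => σ k ^ 2) ((∑ k, σ k + 1) ^ 2 * (δ + e)) := by
  intro x y
  set s := ∑ k, σ k with hs
  have hs0 : 0 ≤ s := Finset.sum_nonneg fun k _ => hσ k
  let S : E → F := fun x => ∑ k, (σ k * inner ℝ (u k) x : ℝ) • v k
  have hcoef : ∀ k x, |σ k * (inner ℝ (u k) x : ℝ)| ≤ σ k * ‖x‖ := fun k x => by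
    rw [abs_mul, abs_of_nonneg (hσ k)]
    have := abs_real_inner_le_norm (u k) x
    rw [hu, one_mul] at this
    have := hσ k
    gcongr
  have hS : ∀ x, ‖S x‖ ≤ s * ‖x‖ := fun x => by
    refine (norm_sum_le _ _).trans ?_
    rw [hs, Finset.sum_mul]
    refine Finset.sum_le_sum fun k _ => ?_
    rw [norm_smul, hv, mul_one, Real.norm_eq_abs]
    exact hcoef k x
  have hSS : |(inner ℝ (S x) (S y) : ℝ)
      - ∑ k, σ k ^ 2 * ((inner ℝ (u k) x : ℝ) * inner ℝ (u k) y)| ≤ s ^ 2 * δ * (‖x‖ * ‖y‖) := by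
    have h1 : (inner ℝ (S x) (S y) : ℝ)
        - ∑ k, σ k ^ 2 * ((inner ℝ (u k) x : ℝ) * inner ℝ (u k) y)
        = ∑ k, ∑ l, (σ k * (inner ℝ (u k) x : ℝ)) * (σ l * (inner ℝ (u l) y : ℝ))
          * ((inner ℝ (v k) (v l) : ℝ) - if k = l then 1 else 0) := by
      simp only [S, sum_inner, inner_sum, real_inner_smul_left, real_inner_smul_right, mul_sub,
        Finset.sum_sub_distrib, mul_ite, mul_one, mul_zero, Finset.sum_ite_eq, Finset.mem_univ,
        if_true]
      congr 1
      · rw [Finset.sum_comm]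
        exact Finset.sum_congr rfl fun k _ => Finset.sum_congr rfl fun l _ => by ring
      · exact Finset.sum_congr rfl fun k _ => by ring
    rw [h1]
    calc _ ≤ ∑ k, ∑ l, (σ k * ‖x‖) * (σ l * ‖y‖) * δ := by
          refine (Finset.abs_sum_le_sum_abs _ _).trans (Finset.sum_le_sum fun k _ => ?_)
          refine (Finset.abs_sum_le_sum_abs _ _).trans (Finset.sum_le_sum fun l _ => ?_)
          rw [abs_mul, abs_mul]
          have h2 : |(inner ℝ (v k) (v l) : ℝ) - if k = l then 1 else 0| ≤ δ := by
            split_ifs with hkl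
            · subst hkl
              rw [real_inner_self_eq_norm_sq, hv]
              simpa using hδ
            · rw [sub_zero]; exact hvv k l hkl
          have := hσ k
          have := hσ l
          gcongr
          · exact hcoef k x
          · exact hcoef l y
      _ = _ := by
          simp only [← Finset.sum_mul, ← Finset.mul_sum, ← hs]
          ring
  have hsplit : (inner ℝ (T x) (T y) : ℝ) = inner ℝ (S x) (S y) + inner ℝ (T x - S x) (S y)
      + inner ℝ (S x) (T y - S y) + inner ℝ (T x - S x) (T y - S y) := by
    simp only [inner_sub_left, inner_sub_right]
    ring
  have h1 : |(inner ℝ (T x - S x) (S y) : ℝ)| ≤ (e * ‖x‖) * (s * ‖y‖) :=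
    (abs_real_inner_le_norm _ _).trans (mul_le_mul (hT x) (hS y) (norm_nonneg _) (by positivity))
  have h2 : |(inner ℝ (S x) (T y - S y) : ℝ)| ≤ (s * ‖x‖) * (e * ‖y‖) :=
    (abs_real_inner_le_norm _ _).trans (mul_le_mul (hS x) (hT y) (norm_nonneg _) (by positivity))
  have h3 : |(inner ℝ (T x - S x) (T y - S y) : ℝ)| ≤ (e * ‖x‖) * (e * ‖y‖) :=
    (abs_real_inner_le_norm _ _).trans (mul_le_mul (hT x) (hT y) (norm_nonneg _) (by positivity))
  rw [hsplit]
  have hxy : 0 ≤ ‖x‖ * ‖y‖ := by positivity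
  have hcoefs : s ^ 2 * δ + 2 * (e * s) + e * e ≤ (s + 1) ^ 2 * (δ + e) := by
    nlinarith [mul_nonneg hs0 hδ, mul_nonneg hs0 he, mul_nonneg (mul_nonneg hs0 hs0) he]
  have htot := mul_le_mul_of_nonneg_right hcoefs hxy
  rw [abs_le] at *
  constructor <;> nlinarith

variable [FiniteDimensional ℝ E] [FiniteDimensional ℝ F]

theorem GramClose.sq_singularValues_le {R : ℕ} {T : E →ₗ[ℝ] F} {u u₀ : Fin R → E} {μ : Fin R → ℝ}
    {η : ℝ} (H : GramClose T u μ η) (hu : Orthonormal ℝ u) (hμ : Antitone μ) (hμ0 : ∀ k, 0 ≤ μ k)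
    (h₀ : IsLeadingRightSingular T u₀) (i : Fin R) : T.singularValues i ^ 2 ≤ μ i + η := by
  obtain ⟨c, hc0, hc⟩ := exists_combination_orthogonal
    (fun l : Fin (i + 1) => u₀ (Fin.castLE i.2 l)) (fun k : Fin i => u (Fin.castLE i.2.le k))
  have hw : Orthonormal ℝ fun l : Fin (i + 1) => u₀ (Fin.castLE i.2 l) :=
    h₀.1.comp _ (Fin.castLE_injective _)
  have hpos := norm_sq_combination_pos hw hc0
  have hnorm := hw.norm_sq_combination c
  set x := ∑ l, c l • u₀ (Fin.castLE i.2 l) with hx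
  have h1 : T.singularValues i ^ 2 * ‖x‖ ^ 2 ≤ ‖T x‖ ^ 2 := by
    have : ‖T x‖ ^ 2 = ∑ l : Fin (i + 1), T.singularValues l ^ 2 * c l ^ 2 := by
      rw [← real_inner_self_eq_norm_sq]
      conv_lhs => enter [2]; rw [hx, map_sum]
      rw [sum_inner]
      refine Finset.sum_congr rfl fun l _ => ?_
      rw [map_smul, real_inner_smul_left, h₀.inner_apply, hx, hw.inner_right_fintype]
      simp only [Fin.val_castLE]
      ring
    rw [this, hnorm, Finset.mul_sum]
    refine Finset.sum_le_sum fun l _ => ?_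
    have h2 := T.singularValues_antitone (Nat.lt_succ_iff.1 l.2)
    have h3 := T.singularValues_nonneg i
    gcongr
  have h2 : ∑ k, μ k * (inner ℝ (u k) x : ℝ) ^ 2 ≤ μ i * ‖x‖ ^ 2 := by
    refine le_trans ?_ (mul_le_mul_of_nonneg_left (hu.sum_inner_sq_le x) (hμ0 i))
    rw [Finset.mul_sum]
    refine Finset.sum_le_sum fun k _ => ?_
    rcases lt_or_ge k i with hk | hk
    · have : (inner ℝ (u k) x : ℝ) = 0 := hc ⟨k, hk⟩
      simp [this]
    · have := hμ hk
      gcongr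
  have h3 := (abs_le.1 (H.abs_norm_sq_sub_le x)).2
  by_contra! hlt
  nlinarith

theorem GramClose.le_sq_singularValues {R : ℕ} {T : E →ₗ[ℝ] F} {u : Fin R → E} {μ : Fin R → ℝ}
    {η : ℝ} (H : GramClose T u μ η) (hu : Orthonormal ℝ u) (hμ : Antitone μ) (hμ0 : ∀ k, 0 ≤ μ k)
    (i : Fin R) : μ i - η ≤ T.singularValues i ^ 2 := by
  obtain ⟨e, he⟩ := exists_orthonormalBasis_isLeadingRightSingular T
  have hR : R ≤ Module.finrank ℝ E := by
    simpa using hu.linearIndependent.fintype_card_le_finrank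
  obtain ⟨c, hc0, hc⟩ := exists_combination_orthogonal
    (fun l : Fin (i + 1) => u (Fin.castLE i.2 l))
    (fun k : Fin i => e (Fin.castLE (i.2.le.trans hR) k))
  have hw : Orthonormal ℝ fun l : Fin (i + 1) => u (Fin.castLE i.2 l) :=
    hu.comp _ (Fin.castLE_injective _)
  have hpos := norm_sq_combination_pos hw hc0
  have hnorm := hw.norm_sq_combination c
  set x := ∑ l, c l • u (Fin.castLE i.2 l) with hx
  have h1 := norm_apply_sq_le_of_orthogonal he i x fun k hk => hc ⟨k, hk⟩
  have h2 : μ i * ‖x‖ ^ 2 ≤ ∑ k, μ k * (inner ℝ (u k) x : ℝ) ^ 2 := by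
    rw [hnorm, Finset.mul_sum]
    calc ∑ l, μ i * c l ^ 2
        ≤ ∑ l : Fin (i + 1), μ (Fin.castLE i.2 l)
            * (inner ℝ (u (Fin.castLE i.2 l)) x : ℝ) ^ 2 := by
          refine Finset.sum_le_sum fun l _ => ?_
          rw [hx, hw.inner_right_fintype]
          have : μ i ≤ μ (Fin.castLE i.2 l) := hμ (Fin.le_def.2 (Nat.lt_succ_iff.1 l.2))
          gcongr
      _ = ∑ k ∈ Finset.univ.map (Fin.castLEEmb (Nat.succ_le_of_lt i.2)),
            μ k * (inner ℝ (u k) x : ℝ) ^ 2 := by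
          rw [Finset.sum_map]; rfl
      _ ≤ _ := Finset.sum_le_sum_of_subset_of_nonneg (Finset.subset_univ _)
          fun k _ _ => mul_nonneg (hμ0 k) (sq_nonneg _)
  have h3 := (abs_le.1 (H.abs_norm_sq_sub_le x)).1
  by_contra! hlt
  nlinarith

end SpectralPerturbation

section UnitVectors

variable {E : Type*} [NormedAddCommGroup E] [InnerProductSpace ℝ E]

theorem min_norm_add_norm_sub_le (a b : E) (ha : ‖a‖ = 1) (hb : ‖b‖ = 1) :
    min ‖a + b‖ ‖a - b‖ ≤ 2 * ‖a - (inner ℝ a b : ℝ) • b‖ := by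
  have h := norm_sub_inner_smul_sq a b hb
  have ht := abs_le.1 ((abs_real_inner_le_norm a b).trans_eq (by rw [ha, hb, one_mul]))
  have h1 := norm_add_sq_real a b
  have h2 := norm_sub_sq_real a b
  rw [ha] at h
  rw [ha, hb] at h1 h2
  set t : ℝ := inner ℝ a b
  rcases le_total 0 t with h0 | h0
  · refine (min_le_right _ _).trans ?_
    rw [← sq_le_sq₀ (norm_nonneg _) (by positivity), mul_pow, h, h2]
    nlinarith
  · refine (min_le_left _ _).trans ?_
    rw [← sq_le_sq₀ (norm_nonneg _) (by positivity), mul_pow, h, h1]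
    nlinarith

/-- If multiples of two rank-one tensors are close to each other, the factors agree up to
sign. -/
theorem min_norm_factor_le {d : ℕ} {n : Fin d → ℕ} (x z : VecTuple n) (hx : ∀ j, ‖x j‖ = 1)
    (hz : ∀ j, ‖z j‖ = 1) (a t : ℝ) (j : Fin d) :
    |a| * min ‖x j + z j‖ ‖x j - z j‖ ≤ 2 * ‖a • outer z - t • outer x‖ := by
  have hox := norm_outer x hx
  have hoz := norm_outer z hz
  have h1 := min_norm_add_norm_sub_le (x j) (z j) (hx j) (hz j)
  have h2 : ‖x j - (inner ℝ (x j) (z j) : ℝ) • z j‖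
      ≤ ‖outer z - (inner ℝ (outer z) (outer x) : ℝ) • outer x‖ := by
    rw [← sq_le_sq₀ (norm_nonneg _) (norm_nonneg _), norm_sub_inner_smul_sq _ _ hox,
      norm_sub_inner_smul_sq _ _ (hz j), hx, hoz]
    have := abs_inner_outer_le z x hz hx j
    rw [real_inner_comm (z j) (x j)]
    have := sq_le_sq.2 this
    linarith
  have h3 := norm_sub_inner_smul_le (a • outer z) (outer x) hox t
  rw [real_inner_smul_left, ← smul_smul, ← smul_sub, norm_smul, Real.norm_eq_abs] at h3
  calc _ ≤ |a| * (2 * ‖outer z - (inner ℝ (outer z) (outer x) : ℝ) • outer x‖) := by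
        gcongr; linarith
    _ ≤ _ := by linarith

end UnitVectors

section ApproximateSingularVectors

variable {E F : Type*} [NormedAddCommGroup E] [InnerProductSpace ℝ E]
  [NormedAddCommGroup F] [InnerProductSpace ℝ F]
  {R : ℕ} {T : E →ₗ[ℝ] F} {u u₀ : Fin R → E} {v : Fin R → F} {σ : Fin R → ℝ} {η e γ : ℝ}

/-- A Ky Fan type bound for a map whose Gram form is close to `∑ μ_k u_k u_kᵀ`. -/
theorem GramClose.sum_norm_apply_sq_le {μ : Fin R → ℝ} (H : GramClose T u μ η)
    (hu : Orthonormal ℝ u) (hμ : ∀ k, 0 ≤ μ k) {w : Fin R → E} (hw : Orthonormal ℝ w) :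
    ∑ i, ‖T (w i)‖ ^ 2 ≤ ∑ k, μ k + R * η := by
  have h1 : ∀ i, ‖T (w i)‖ ^ 2 ≤ ∑ k, μ k * (inner ℝ (u k) (w i) : ℝ) ^ 2 + η := fun i => by
    have := (abs_le.1 (H.abs_norm_sq_sub_le (w i))).2
    rw [hw.1 i] at this
    linarith
  refine (Finset.sum_le_sum fun i _ => h1 i).trans ?_
  rw [Finset.sum_add_distrib, Finset.sum_comm]
  simp only [Finset.sum_const, Finset.card_univ, Fintype.card_fin, nsmul_eq_mul]
  gcongr with k
  rw [← Finset.mul_sum]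
  refine mul_le_of_le_one_right (hμ k) ?_
  have := hw.sum_inner_sq_le (u k)
  rw [hu.1 k] at this
  simpa only [real_inner_comm, one_pow] using this

theorem half_le_abs_inner {a b : E} {r : ℝ} (ha : ‖a‖ = 1) (hb : ‖b‖ = 1)
    (h : ‖a - (inner ℝ a b : ℝ) • b‖ ≤ r) (hr : r ≤ 1 / 2) : 1 / 2 ≤ |(inner ℝ a b : ℝ)| := by
  have := norm_sub_norm_le a ((inner ℝ a b : ℝ) • b)
  rw [norm_smul, ha, hb, mul_one, Real.norm_eq_abs] at this
  linarith

variable [FiniteDimensional ℝ E] [FiniteDimensional ℝ F]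

/-- Under the gap condition on `σ`, the leading singular vectors of a perturbation of
`∑ σ_k v_k u_kᵀ` and their images are close to those of the unperturbed map. -/
theorem leadingRightSingular_perturbation (H : GramClose T u (fun k => σ k ^ 2) η)
    (hu : Orthonormal ℝ u) (hv : ∀ k, ‖v k‖ = 1) (hσ : StrictAnti σ) (hσ_pos : ∀ i, 0 < σ i)
    (hT : ∀ x, ‖T x - ∑ k, (σ k * inner ℝ (u k) x : ℝ) • v k‖ ≤ e * ‖x‖)
    (h₀ : IsLeadingRightSingular T u₀) (hγ : 0 < γ) (hη : 0 ≤ η) (hηγ : η ≤ γ)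
    (hgap : ∀ i k, k ≠ i → 2 * γ ≤ |σ i ^ 2 - σ k ^ 2|) (hpos : ∀ i, 2 * γ ≤ σ i ^ 2)
    (i : Fin R) :
    ‖u₀ i - (inner ℝ (u₀ i) (u i) : ℝ) • u i‖ ≤ (R + 1) * (η / γ) ∧
    ‖T (u₀ i) - (σ i * inner ℝ (u i) (u₀ i) : ℝ) • v i‖ ≤ (∑ k, σ k) * (η / γ) + e ∧
    σ i ^ 2 - η ≤ ‖T (u₀ i)‖ ^ 2 := by
  have hμ : Antitone fun k => σ k ^ 2 := fun k l hkl =>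
    pow_le_pow_left₀ (hσ_pos l).le (hσ.antitone hkl) 2
  have hup := H.sq_singularValues_le hu hμ (fun k => sq_nonneg _) h₀ i
  have hlow := H.le_sq_singularValues hu hμ (fun k => sq_nonneg _) i
  have hx := h₀.1.1 i
  have hlam := h₀.inner_apply i
  have hgap' : ∀ k, k ≠ i → γ ≤ |T.singularValues i ^ 2 - σ k ^ 2| := fun k hk => by
    have h1 := hgap i k hk
    have h2 : |σ i ^ 2 - σ k ^ 2| ≤
        |T.singularValues i ^ 2 - σ k ^ 2| + |σ i ^ 2 - T.singularValues i ^ 2| := by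
      rw [add_comm]; exact abs_sub_le _ _ _
    have h3 : |σ i ^ 2 - T.singularValues i ^ 2| ≤ γ := abs_le.2 ⟨by linarith, by linarith⟩
    linarith
  have hcoef : ∀ k, k ≠ i → |(inner ℝ (u k) (u₀ i) : ℝ)| ≤ η / γ := fun k hk =>
    H.abs_inner_le hu hx hlam hγ (hgap' k hk)
  refine ⟨H.norm_sub_inner_smul_le hu hx hlam hγ hη hgap' (by linarith [hpos i]), ?_, ?_⟩
  · have h1 := hT (u₀ i)
    rw [hx, mul_one] at h1
    have h2 : T (u₀ i) - (σ i * inner ℝ (u i) (u₀ i) : ℝ) • v i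
        = ∑ k ∈ Finset.univ.erase i, (σ k * inner ℝ (u k) (u₀ i) : ℝ) • v k
          + (T (u₀ i) - ∑ k, (σ k * inner ℝ (u k) (u₀ i) : ℝ) • v k) := by
      rw [← Finset.add_sum_erase Finset.univ (fun k => (σ k * inner ℝ (u k) (u₀ i) : ℝ) • v k)
        (Finset.mem_univ i)]
      abel
    rw [h2]
    refine (norm_add_le _ _).trans (add_le_add ?_ h1)
    calc _ ≤ ∑ k ∈ Finset.univ.erase i, ‖(σ k * inner ℝ (u k) (u₀ i) : ℝ) • v k‖ :=
          norm_sum_le _ _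
      _ ≤ ∑ k ∈ Finset.univ.erase i, σ k * (η / γ) := by
          refine Finset.sum_le_sum fun k hk => ?_
          rw [norm_smul, hv, mul_one, Real.norm_eq_abs, abs_mul, abs_of_pos (hσ_pos k)]
          have := (hσ_pos k).le
          gcongr
          exact hcoef k (Finset.ne_of_mem_erase hk)
      _ ≤ ∑ k, σ k * (η / γ) :=
          Finset.sum_le_sum_of_subset_of_nonneg (Finset.subset_univ _)
            fun k _ _ => mul_nonneg (hσ_pos k).le (by positivity)
      _ = _ := by rw [Finset.sum_mul]
  · rw [h₀.norm_apply_sq]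
    exact hlow

end ApproximateSingularVectors

section Objective

variable {m R : ℕ} {n : Fin (m + 1) → ℕ}

theorem isCompact_setOf_feasible : IsCompact {V : FactorTuple n R | Feasible V} := by
  refine Metric.isCompact_of_isClosed_isBounded ?_ ?_
  · have h : {V : FactorTuple n R | Feasible V} =
        (⋂ (j : Fin m) (i : Fin R), {V : FactorTuple n R | ‖V j.castSucc i‖ = 1}) ∩
        ⋂ (i : Fin R) (k : Fin R), {V : FactorTuple n R |
          (inner ℝ (V (Fin.last m) i) (V (Fin.last m) k) : ℝ) = if i = k then 1 else 0} := by
      ext V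
      simp [Feasible, orthonormal_iff_ite]
    rw [h]
    refine IsClosed.inter (isClosed_iInter fun j => isClosed_iInter fun i => ?_)
      (isClosed_iInter fun i => isClosed_iInter fun k => ?_)
    · exact isClosed_eq (by fun_prop) continuous_const
    · exact isClosed_eq (by fun_prop) continuous_const
  · refine (Metric.isBounded_closedBall (x := 0) (r := 1)).subset fun V hV => ?_
    rw [mem_closedBall_zero_iff, pi_norm_le_iff_of_nonneg zero_le_one]
    intro j
    rw [pi_norm_le_iff_of_nonneg zero_le_one]
    intro i
    induction j using Fin.lastCases with
    | last => exact (hV.2.1 i).le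
    | cast j => exact (hV.1 j i).le

theorem continuous_outer {d : ℕ} {n : Fin d → ℕ} :
    Continuous (outer : VecTuple n → Tensor n) := by
  unfold outer
  fun_prop

theorem continuous_objective (A : Tensor n) :
    Continuous (objective A : FactorTuple n R → ℝ) := by
  have := continuous_outer (n := n)
  unfold objective
  fun_prop

theorem exists_isGreatest_objective (A : Tensor n) {U : FactorTuple n R} (hU : Feasible U) :
    ∃ g, IsGreatest {g : ℝ | ∃ V : FactorTuple n R, Feasible V ∧ g = objective A V} g := by
  obtain ⟨V, hV, hmax⟩ := isCompact_setOf_feasible.exists_isMaxOn ⟨U, hU⟩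
    (continuous_objective A).continuousOn
  refine ⟨objective A V, ⟨V, hV, rfl⟩, ?_⟩
  rintro _ ⟨W, hW, rfl⟩
  exact hmax hW

theorem objective_eq (A : Tensor n) (V : FactorTuple n R) :
    objective A V = ∑ i, (inner ℝ (contractLast A (V (Fin.last m) i))
      (outer fun j : Fin m => V j.castSucc i) : ℝ) ^ 2 := by
  refine Finset.sum_congr rfl fun i _ => ?_
  rw [outer_eq_tensorSnoc, inner_tensorSnoc]

theorem objective_le (A : Tensor n) {V : FactorTuple n R} (hV : Feasible V) :
    objective A V ≤ ∑ i, ‖contractLast A (V (Fin.last m) i)‖ ^ 2 := by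
  rw [objective_eq]
  refine Finset.sum_le_sum fun i _ => ?_
  rw [← sq_abs]
  have := abs_real_inner_le_norm (contractLast A (V (Fin.last m) i))
    (outer fun j : Fin m => V j.castSucc i)
  rw [norm_outer _ fun j => hV.1 j i, mul_one] at this
  gcongr

end Objective

theorem exists_pos_forall_le {ι : Type*} [Finite ι] (f : ι → ℝ) (hf : ∀ i, 0 < f i) :
    ∃ γ > 0, ∀ i, γ ≤ f i := by
  rcases isEmpty_or_nonempty ι with h | h
  · exact ⟨1, one_pos, fun i => h.elim i⟩
  · obtain ⟨i, hi⟩ := Finite.exists_min f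
    exact ⟨f i, hf i, hi⟩

theorem exists_spectral_gap {R : ℕ} {σ : Fin R → ℝ} (hσ : StrictAnti σ) (hσ_pos : ∀ i, 0 < σ i) :
    ∃ γ > 0, (∀ i k, k ≠ i → 2 * γ ≤ |σ i ^ 2 - σ k ^ 2|) ∧ (∀ i, 2 * γ ≤ σ i ^ 2) ∧
      ∀ i, γ ≤ σ i := by
  obtain ⟨a, ha, ha'⟩ := exists_pos_forall_le
    (fun p : {p : Fin R × Fin R // p.2 ≠ p.1} => |σ p.1.1 ^ 2 - σ p.1.2 ^ 2|) fun p => by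
      refine abs_pos.2 (sub_ne_zero.2 fun h => p.2 (hσ.injective ?_).symm)
      exact (pow_left_inj₀ (hσ_pos _).le (hσ_pos _).le two_ne_zero).1 h
  obtain ⟨b, hb, hb'⟩ := exists_pos_forall_le (fun i => σ i ^ 2) fun i => pow_pos (hσ_pos i) 2
  obtain ⟨c, hc, hc'⟩ := exists_pos_forall_le σ hσ_pos
  refine ⟨min (a / 2) (min (b / 2) c), by positivity, fun i k hk => ?_, fun i => ?_, fun i => ?_⟩
  · have := ha' ⟨(i, k), hk⟩
    have := min_le_left (a / 2) (min (b / 2) c)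
    dsimp only at *
    linarith
  · have := hb' i
    have := (min_le_right (a / 2) _).trans (min_le_left (b / 2) c)
    linarith
  · exact ((min_le_right _ _).trans (min_le_right _ _)).trans (hc' i)

section Main

variable {m R : ℕ} {n : Fin (m + 1) → ℕ}

theorem norm_contractLast_sub_le (U : FactorTuple n R) (σ : Fin R → ℝ) (E : Tensor n)
    (x : EuclideanSpace ℝ (Fin (n (Fin.last m)))) :
    ‖contractLast ((∑ i : Fin R, σ i • outer (fun j => U j i)) + E) x
      - ∑ k, (σ k * inner ℝ (U (Fin.last m) k) x : ℝ) • outer fun j : Fin m => U j.castSucc k‖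
      ≤ ‖E‖ * ‖x‖ := by
  have h : contractLast ((∑ i : Fin R, σ i • outer (fun j => U j i)) + E) x
      - ∑ k, (σ k * inner ℝ (U (Fin.last m) k) x : ℝ) • (outer fun j : Fin m => U j.castSucc k)
      = contractLast E x := by
    rw [contractLast_add, contractLast_sum, add_comm, add_sub_assoc]
    simp [contractLast_smul, outer_eq_tensorSnoc, contractLast_tensorSnoc, smul_smul]
  rw [h]
  exact norm_contractLast_le E x

theorem gramClose_unfoldLast {U : FactorTuple n R} {σ : Fin R → ℝ} {δ : ℝ} {A E : Tensor n}
    (hU : Feasible U) (hδ : 0 ≤ δ) (hinc : Incoherent δ U) (hσ : ∀ k, 0 ≤ σ k)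
    (hA : A = (∑ i : Fin R, σ i • outer (fun j => U j i)) + E) (hE : ‖E‖ ≤ 1) :
    GramClose (Matrix.toEuclideanLin (unfoldLast A).transpose) (U (Fin.last m))
      (fun k => σ k ^ 2) ((∑ k, σ k + 1) ^ 2 * (δ + ‖E‖)) := by
  refine gramClose_of_approx (v := fun k => outer fun j : Fin m => U j.castSucc k) hU.2.1
    (fun k => norm_outer _ fun j => hU.1 j k) (fun k l hkl => ?_) hσ hδ (norm_nonneg _) hE
    fun x => ?_
  · obtain ⟨j, hj⟩ := hinc
    exact (abs_inner_outer_le _ _ (fun j => hU.1 j k) (fun j => hU.1 j l) j).trans (hj k l hkl)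
  · rw [toEuclideanLin_unfoldLast_transpose, hA]
    exact norm_contractLast_sub_le U σ E x

theorem min_norm_factor_le_of_approx {d : ℕ} {n : Fin d → ℕ} {C : Tensor n} {x z : VecTuple n}
    {a t f f' g : ℝ} (hx : ∀ j, ‖x j‖ = 1) (hz : ∀ j, ‖z j‖ = 1) (hCz : ‖C - a • outer z‖ ≤ f)
    (hCx : ‖C - t • outer x‖ ≤ f') (hg : g ≤ |a|) (j : Fin d) :
    g * min ‖x j + z j‖ ‖x j - z j‖ ≤ 2 * (f + f') := by
  have h1 := min_norm_factor_le x z hx hz a t j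
  have h2 := norm_sub_le_norm_sub_add_norm_sub (a • outer z) C (t • outer x)
  rw [norm_sub_rev (a • outer z) C] at h2
  have h3 : g * min ‖x j + z j‖ ‖x j - z j‖ ≤ |a| * min ‖x j + z j‖ ‖x j - z j‖ := by gcongr
  linarith

theorem IsUnitQuasiOptimal.mono {d : ℕ} {n : Fin d → ℕ} {κ κ' : ℝ} {P : RankOneProcedure n}
    (h : IsUnitQuasiOptimal κ P) (hκ : κ ≤ κ') : IsUnitQuasiOptimal κ' P := fun C x hx =>
  ⟨(h C x hx).1, fun c z hz => ((h C x hx).2 c z hz).trans (by gcongr)⟩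

/-- The three kinds of rank-one procedures are all quasi-optimal. -/
theorem exists_isUnitQuasiOptimal (hm : 0 < m) {P : RankOneProcedure (dropLast n)}
    (hP : (∃ κ : ℝ, IsQuasiOptimal κ P) ∨ P = bestRankOne (dropLast n) ∨
      ∃ rule : ExtractionRule, P = sequentialRankOne rule (dropLast n)) :
    ∃ κ : ℝ, 0 ≤ κ ∧ IsUnitQuasiOptimal κ P := by
  suffices h : ∃ κ : ℝ, IsUnitQuasiOptimal κ P by
    obtain ⟨κ, hκ⟩ := h
    exact ⟨|κ|, abs_nonneg κ, hκ.mono (le_abs_self κ)⟩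
  obtain ⟨m, rfl⟩ := Nat.exists_eq_succ_of_ne_zero hm.ne'
  rcases hP with ⟨κ, h⟩ | rfl | ⟨rule, rfl⟩
  · exact ⟨κ, h.isUnitQuasiOptimal 0⟩
  · exact ⟨1, bestRankOne_isUnitQuasiOptimal _ 0⟩
  · exact exists_sequentialRankOne_isUnitQuasiOptimal rule _

end Main

end

set_option maxHeartbeats 1000000 in
theorem mainTheorem5 {m R : ℕ} (hm : 2 ≤ m) (n : Fin (m + 1) → ℕ)
    (σ : Fin R → ℝ) (hσ : StrictAnti σ) (hσ_pos : ∀ i, 0 < σ i)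
    (P : RankOneProcedure (dropLast n))
    (hP : (∃ κ : ℝ, IsQuasiOptimal κ P) ∨ P = bestRankOne (dropLast n) ∨
      ∃ rule : ExtractionRule, P = sequentialRankOne rule (dropLast n)) :
    ∃ ε C₁ C₂ : ℝ, 0 < ε ∧ 0 ≤ C₁ ∧ 0 ≤ C₂ ∧
      ∀ (U : FactorTuple n R) (E A : Tensor n) (δ : ℝ),
        Feasible U → 0 ≤ δ → δ < 1 → Incoherent δ U →
        A = (∑ i : Fin R, σ i • outer (fun j => U j i)) + E →
        δ ≤ ε → ‖E‖ ≤ ε →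
        ∀ U₀ : FactorTuple n R, IsAlgorithmOutput P A U₀ →
          (∃ Gmax : ℝ,
            IsGreatest {g : ℝ | ∃ V : FactorTuple n R, Feasible V ∧ g = objective A V} Gmax ∧
            Gmax - C₁ * δ - C₂ * ‖E‖ ≤ objective A U₀ ∧ objective A U₀ ≤ Gmax) ∧
          ∀ (j : Fin (m + 1)) (i : Fin R),
            min ‖U₀ j i + U j i‖ ‖U₀ j i - U j i‖ ≤ C₁ * δ + C₂ * ‖E‖ := by
  obtain ⟨κ, hκ, hPκ⟩ := exists_isUnitQuasiOptimal (by lia) hP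
  obtain ⟨γ, hγ, hgap, hpos, hγσ⟩ := exists_spectral_gap hσ hσ_pos
  set s := ∑ k, σ k with hs
  have hs0 : 0 ≤ s := Finset.sum_nonneg fun k _ => (hσ_pos k).le
  set K := (s + 1) ^ 2 with hK
  have hK0 : 0 ≤ K := by positivity
  set L := (R + 1) * (K / γ) with hL
  have hL0 : 0 ≤ L := by positivity
  set F := s * (K / γ) + 1 with hF
  have hF0 : 0 ≤ F := by positivity
  set D := 1 + K / γ + 2 * L with hD
  have hKγ0 : 0 ≤ K / γ := by positivity
  have hD0 : 0 < D := by positivity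
  set c₁ := 2 * L with hc₁
  set c₂ := 4 * ((1 + κ) * F) / γ with hc₂
  set c₃ := R * (2 * K + κ ^ 2 * F ^ 2) with hc₃
  have hc₁0 : 0 ≤ c₁ := by positivity
  have hc₂0 : 0 ≤ c₂ := by positivity
  have hc₃0 : 0 ≤ c₃ := by positivity
  refine ⟨1 / (2 * D), c₁ + c₂ + c₃, c₁ + c₂ + c₃, by positivity, by positivity, by positivity, ?_⟩
  intro U E A δ hU hδ _ hinc hA hδε hEε U₀ ⟨hlead, hrank⟩
  set ω := δ + ‖E‖ with hω
  have hE0 : 0 ≤ ‖E‖ := norm_nonneg E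
  have hω0 : 0 ≤ ω := by positivity
  have hωD : ω * D ≤ 1 := by
    have : ω ≤ 1 / D := by
      have : 1 / D = 1 / (2 * D) + 1 / (2 * D) := by field_simp; norm_num
      rw [this]
      exact add_le_add hδε hEε
    rwa [le_div_iff₀ hD0] at this
  have hωK0 : 0 ≤ ω * (K / γ) := by positivity
  have hωL0 : 0 ≤ ω * L := by positivity
  have hωD' : ω + ω * (K / γ) + 2 * (ω * L) ≤ 1 := by rw [hD] at hωD; linarith
  have hω1 : ω ≤ 1 := by linarith
  have hE1 : ‖E‖ ≤ 1 := by linarith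
  have hηγ : K * ω ≤ γ := by
    have : ω * (K / γ) ≤ 1 := by linarith
    rwa [mul_div_assoc', div_le_one hγ, mul_comm] at this
  have hLω : L * ω ≤ 1 / 2 := by linarith
  have H := gramClose_unfoldLast hU hδ hinc (fun k => (hσ_pos k).le) hA hE1
  have hT : ∀ x, ‖Matrix.toEuclideanLin (unfoldLast A).transpose x
      - ∑ k, (σ k * inner ℝ (U (Fin.last m) k) x : ℝ) • (outer fun j : Fin m => U j.castSucc k)‖
      ≤ ‖E‖ * ‖x‖ := fun x => by
    rw [toEuclideanLin_unfoldLast_transpose, hA]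
    exact norm_contractLast_sub_le U σ E x
  have hpert := fun i => leadingRightSingular_perturbation H hU.2
    (fun k => norm_outer _ fun j => hU.1 j k) hσ hσ_pos hT hlead hγ (by positivity) hηγ hgap hpos i
  simp only [toEuclideanLin_unfoldLast_transpose, ← hs, ← hK, ← hω] at hpert
  have hLeq : (R + 1) * (K * ω / γ) = L * ω := by rw [hL]; ring
  have hFle : s * (K * ω / γ) + ‖E‖ ≤ F * ω := by
    have : s * (K * ω / γ) = s * (K / γ) * ω := by ring
    rw [this, hF, add_mul, one_mul]
    linarith
  have hFeas₀ : Feasible U₀ := ⟨fun j i => (hPκ _ _ (hrank i)).1 j, hlead.1⟩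
  have herr : ∀ i, ‖contractLast A (U₀ (Fin.last m) i)
      - (inner ℝ (contractLast A (U₀ (Fin.last m) i)) (outer fun j : Fin m => U₀ j.castSucc i) : ℝ)
        • (outer fun j : Fin m => U₀ j.castSucc i)‖ ≤ κ * (F * ω) := fun i => by
    refine ((hPκ _ _ (hrank i)).2 (σ i * inner ℝ (U (Fin.last m) i) (U₀ (Fin.last m) i))
      (fun j => U j.castSucc i) fun j => hU.1 j i).trans ?_
    gcongr
    exact (hpert i).2.1.trans hFle
  constructor
  · obtain ⟨g, hg⟩ := exists_isGreatest_objective A hU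
    refine ⟨g, hg, ?_, hg.2 ⟨U₀, hFeas₀, rfl⟩⟩
    obtain ⟨V, hV, rfl⟩ := hg.1
    have hupper : objective A V ≤ ∑ k, σ k ^ 2 + R * (K * ω) := by
      have := H.sum_norm_apply_sq_le hU.2 (fun k => sq_nonneg (σ k)) hV.2
      simp only [toEuclideanLin_unfoldLast_transpose] at this
      exact (objective_le A hV).trans this
    have hlower : ∑ k, σ k ^ 2 - R * (K * ω + (κ * (F * ω)) ^ 2) ≤ objective A U₀ := by
      have : (R : ℝ) * (K * ω + (κ * (F * ω)) ^ 2)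
          = ∑ _k : Fin R, (K * ω + (κ * (F * ω)) ^ 2) := by
        rw [Finset.sum_const, Finset.card_univ, Fintype.card_fin, nsmul_eq_mul]
      rw [objective_eq, this, ← Finset.sum_sub_distrib]
      refine Finset.sum_le_sum fun i _ => ?_
      have h1 := norm_sub_inner_smul_sq (contractLast A (U₀ (Fin.last m) i))
        (outer fun j : Fin m => U₀ j.castSucc i) (norm_outer _ fun j => hFeas₀.1 j i)
      have h2 := pow_le_pow_left₀ (norm_nonneg _) (herr i) 2
      have h3 := (hpert i).2.2
      linarith
    have hsq : (κ * (F * ω)) ^ 2 ≤ κ ^ 2 * F ^ 2 * ω := by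
      have : ω ^ 2 ≤ ω := by nlinarith
      calc (κ * (F * ω)) ^ 2 = κ ^ 2 * F ^ 2 * ω ^ 2 := by ring
        _ ≤ _ := by gcongr
    have hR : (R : ℝ) * (K * ω) + R * (K * ω + (κ * (F * ω)) ^ 2) ≤ c₃ * ω := by
      calc _ ≤ (R : ℝ) * (K * ω) + R * (K * ω + κ ^ 2 * F ^ 2 * ω) := by gcongr
        _ = _ := by rw [hc₃]; ring
    have : c₃ * ω ≤ (c₁ + c₂ + c₃) * ω := by gcongr; linarith
    rw [hω] at this hR
    rw [hω] at hupper hlower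
    linarith
  · intro j i
    rw [← mul_add, ← hω]
    have hdir : ‖U₀ (Fin.last m) i
        - (inner ℝ (U₀ (Fin.last m) i) (U (Fin.last m) i) : ℝ) • U (Fin.last m) i‖ ≤ L * ω :=
      (hpert i).1.trans_eq hLeq
    have h₂ω : 0 ≤ c₂ * ω := by positivity
    have h₃ω : 0 ≤ c₃ * ω := by positivity
    have h₁ω : 0 ≤ c₁ * ω := by positivity
    induction j using Fin.lastCases with
    | last =>
      have := min_norm_add_norm_sub_le _ _ (hlead.1.1 i) (hU.2.1 i)
      linarith
    | cast j =>
      set a := σ i * (inner ℝ (U (Fin.last m) i) (U₀ (Fin.last m) i) : ℝ) with ha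
      have hhalf := half_le_abs_inner (hlead.1.1 i) (hU.2.1 i) hdir hLω
      have hga : γ / 2 ≤ |a| := by
        rw [ha, abs_mul, abs_of_pos (hσ_pos i), real_inner_comm]
        have := hγσ i
        nlinarith
      have h5 := min_norm_factor_le_of_approx (fun j => hFeas₀.1 j i) (fun j => hU.1 j i)
        ((hpert i).2.1.trans hFle) (herr i) hga j
      set μ := min ‖U₀ j.castSucc i + U j.castSucc i‖ ‖U₀ j.castSucc i - U j.castSucc i‖ with hμ
      have h6 : μ ≤ c₂ * ω := by
        rw [hc₂, div_mul_eq_mul_div, le_div_iff₀ hγ]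
        linarith only [h5]
      linarith only [h6, h₁ω, h₃ω]
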